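/- Let $\alpha>-\tfrac12$, $\gamma>-1$, $\alpha+\beta+\gamma>-\tfrac32$ be real numbers, let $W=\{W_t,\ t\ge0\}$ be a Wiener process, and let $$X_t=\int_0^t s^{\alpha}\int_s^t u^{\beta}(u-s)^{\gamma}\,du\,dW_s,\qquad t\ge 0,$$ where the outer integral is the Wiener integral of a deterministic square-integrable kernel. Write $\operatorname{corr}(U,V)=\operatorname{cov}(U,V)/\sqrt{\operatorname{var}U\,\operatorname{var}V}$ for the Pearson correlation. Then there is a constant $c>0$ that depends only on $\alpha,\beta,\gamma$ such that, as $t\to+\infty$, $$\operatorname{corr}(X_1,X_{t+1}-X_t)\sim\begin{cases} c\,t^{\gamma-\alpha}, & \gamma<-\tfrac12,\\ c\,t^{-1/2-\alpha}(\log t)^{-1/2}, & \gamma=-\tfrac12,\\ c\,t^{-1/2-\alpha}, & \gamma>-\tfrac12,\end{cases}$$ where $f\sim g$ means that $f(t)/g(t)\to1$. Consequently, if $\min(\gamma,-\tfrac12)<\alpha-1$, then $$\sum_{n=1}^\infty \operatorname{corr}(X_1,X_{n+1}-X_n)<\infty\quad\text{and}\quad \int_0^\infty \operatorname{corr}(X_1,X_{t+1}-X_t)\,dt<\infty,$$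 and otherwise, that is, if $\alpha\le\tfrac12$ and $\gamma\ge\alpha-1$, then $$\sum_{n=1}^\infty \operatorname{corr}(X_1,X_{n+1}-X_n)=\infty\quad\text{and}\quad \int_1^\infty \operatorname{corr}(X_1,X_{t+1}-X_t)\,dt=\infty.$$ -/

import Mathlib

open MeasureTheory ProbabilityTheory Filter Set Asymptotics
open scoped NNReal ENNReal Topology

noncomputable section

namespace GaussianVolterra

variable {Ω : Type*} [MeasurableSpace Ω]

/-- The step function `∑ b, c b • 1_{(0, b]}` on `(0, ∞)`. Every step function on `(0, ∞)`,
a finite linear combination of indicators of bounded intervals `(a, b]`, has this form. -/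
def stepFun (c : ℝ≥0 →₀ ℝ) (s : ℝ) : ℝ :=
  c.sum fun b x => x * (Ioc 0 (b : ℝ)).indicator 1 s

/-- The elementary stochastic integral `∑ b, c b * (W b - W 0)` of `stepFun c` against `W`. -/
def stepIntegral (W : ℝ≥0 → Ω → ℝ) (c : ℝ≥0 →₀ ℝ) (ω : Ω) : ℝ :=
  c.sum fun b x => x * (W b ω - W 0 ω)

/-- `Y` is a version of the Wiener integral `∫₀^∞ f(s) dW_s` of the deterministic function
`f ∈ L²(0, ∞)`: it is the limit in `L²(P)` of the elementary integrals of some step functions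
that converge to `f` in `L²(0, ∞)`. -/
def IsWienerIntegral (W : ℝ≥0 → Ω → ℝ) (P : Measure Ω) (f : ℝ → ℝ) (Y : Ω → ℝ) : Prop :=
  MemLp f 2 (volume.restrict (Ioi 0)) ∧ MemLp Y 2 P ∧
    ∃ φ : ℕ → (ℝ≥0 →₀ ℝ),
      Tendsto (fun n => eLpNorm (fun s => stepFun (φ n) s - f s) 2 (volume.restrict (Ioi 0)))
        atTop (𝓝 0) ∧
      Tendsto (fun n => eLpNorm (fun ω => stepIntegral W (φ n) ω - Y ω) 2 P) atTop (𝓝 0)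

open Classical in
/-- The Wiener integral `∫₀^∞ f(s) dW_s` (a choice of a version; `0` if the integral does not
exist, that is, for `W` a Wiener process, if `f ∉ L²(0, ∞)`). -/
def wienerIntegral (W : ℝ≥0 → Ω → ℝ) (P : Measure Ω) (f : ℝ → ℝ) : Ω → ℝ :=
  if h : ∃ Y, IsWienerIntegral W P f Y then h.choose else 0

/-- The Volterra kernel `K(t, s) = s^α ∫_s^t u^β (u - s)^γ du` for `0 < s < t`, extended by `0`
to all other `s`. -/
def kernel (α β γ t : ℝ) : ℝ → ℝ :=
  (Ioo 0 t).indicator fun s => s ^ α * ∫ u in s..t, u ^ β * (u - s) ^ γ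

/-- The Gaussian Volterra process `X_t = ∫₀^t K(t, s) dW_s`. -/
def volterraProcess (W : ℝ≥0 → Ω → ℝ) (P : Measure Ω) (α β γ t : ℝ) : Ω → ℝ :=
  wienerIntegral W P (kernel α β γ t)

/-- The Pearson correlation coefficient of two real random variables. -/
def corr (U V : Ω → ℝ) (P : Measure Ω) : ℝ :=
  covariance U V P / (√(variance U P) * √(variance V P))

end GaussianVolterra

end

/-! The Wiener integral is a centred isometry from L²(0, ∞) into L²(P), so the correlation is a
deterministic quotient built from the kernel K. This is why `c` depends on neither the probability
space nor the version of the process.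

Covariance. For s < 1 and large t, K(t+1, s) - K(t, s) is s^α times the integral of u^β (u - s)^γ
over [t, t+1], hence about s^α t^(β+γ). The covariance is therefore asymptotic to t^(β+γ) ∫₀¹ K(1,
s) s^α ds (`tendsto_covariance`).

Variance. On [t, t+1] the factor u^β may be replaced by t^β at the cost of a factor tending to 1
(`variance_mem_Icc`). With v = t - s this leaves t^(2β) times `incrVar`, the integral over v ∈ (-1,
t) of (t - v)^(2α) `incr γ v`², where `incr γ v` behaves like v^γ for large v. Three regimes arise.
If γ < -1/2, then `incr`² is integrable, bounded v dominate, and `incrVar` is of order t^(2α). If γ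
> -1/2, all v of order t contribute, and scaling v = t x gives t^(2α+2γ+1) times a Beta integral. If
γ = -1/2, all logarithmic scales between 1 and t contribute equally, and the substitution v = t^y
gives t^(2α) log t.

Writing `incrVar` ~ L t^(2α) ψ(t), the powers of β cancel and the correlation is asymptotic to c
t^(γ-α) / √ψ(t). Convergence follows by comparison with t^e, e < -1. Divergence in every remaining
case, including the borderline α = 1/2, γ = -1/2, follows by comparison with 1 / (t √(log t)), whose
primitive 2 √(log t) is unbounded. -/

namespace GaussianVolterra

/-! ### L² preliminaries and density of step functions -/

section Hilbert

variable {ι α : Type*} [MeasurableSpace α] {μ : Measure α}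

theorem memLp_finsuppSum {f : ι → α → ℝ} (hf : ∀ i, MemLp (f i) 2 μ) (c : ι →₀ ℝ) :
    MemLp (fun a => c.sum fun i x => x * f i a) 2 μ := by
  simp only [Finsupp.sum]
  exact memLp_finsetSum _ fun i _ => (hf i).const_mul _

/-- Used for both step functions and elementary integrals: the isometry then follows by bilinearity
from its values on the generators. -/
theorem toLp_finsuppSum {f : ι → α → ℝ} (hf : ∀ i, MemLp (f i) 2 μ) (c : ι →₀ ℝ) :
    (memLp_finsuppSum hf c).toLp _ =
      Finsupp.linearCombination ℝ (fun i => (hf i).toLp (f i)) c := by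
  induction c using Finsupp.induction_linear with
  | zero => simp; rfl
  | add c d hc hd =>
    rw [map_add, ← hc, ← hd, ← MemLp.toLp_add]
    congr 1
    funext a
    simp only [Pi.add_apply]
    exact Finsupp.sum_add_index' (by simp) (by intros; ring)
  | single i x =>
    rw [Finsupp.linearCombination_single, ← MemLp.toLp_const_smul]
    congr 1
    funext a
    simp [Finsupp.sum_single_index]

theorem inner_toLp {f g : α → ℝ} (hf : MemLp f 2 μ) (hg : MemLp g 2 μ) :
    inner ℝ (hf.toLp f) (hg.toLp g) = ∫ a, f a * g a ∂μ := by
  rw [L2.inner_def]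
  refine integral_congr_ae ?_
  filter_upwards [hf.coeFn_toLp, hg.coeFn_toLp] with a h1 h2
  rw [h1, h2]
  simp [mul_comm]

theorem inner_linearCombination {E : Type*} [NormedAddCommGroup E] [InnerProductSpace ℝ E]
    (v : ι → E) (c d : ι →₀ ℝ) :
    inner ℝ (Finsupp.linearCombination ℝ v c) (Finsupp.linearCombination ℝ v d) =
      c.sum fun i x => d.sum fun j y => x * (y * inner ℝ (v i) (v j)) := by
  simp only [Finsupp.linearCombination_apply, Finsupp.sum, sum_inner, inner_sum, inner_smul_left,
    inner_smul_right, Finset.mul_sum]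
  rw [Finset.sum_comm]
  refine Finset.sum_congr rfl fun i _ => Finset.sum_congr rfl fun j _ => ?_
  simp only [conj_trivial]
  ring

end Hilbert

/-- A square-integrable function whose primitive vanishes on `(0, ∞)` is zero. -/
theorem ae_eq_zero_of_setIntegral_Ioc_eq_zero {h : ℝ → ℝ}
    (hh : MemLp h 2 (volume.restrict (Ioi 0)))
    (h0 : ∀ b : ℝ≥0, ∫ s in Ioc 0 (b : ℝ), h s = 0) : h =ᵐ[volume.restrict (Ioi 0)] 0 := by
  have hint : ∀ b : ℝ, IntegrableOn h (Ioc 0 b) := fun b => by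
    have : MemLp h 2 (volume.restrict (Ioc 0 b)) :=
      hh.mono_measure (Measure.restrict_mono Ioc_subset_Ioi_self le_rfl)
    exact this.integrable (by norm_num)
  have hloc : LocallyIntegrable ((Ioi 0).indicator h) := by
    rw [locallyIntegrable_iff]
    intro k hk
    obtain ⟨b, hb⟩ := hk.bddAbove
    have : IntegrableOn ((Ioi 0).indicator h) (Iic b) := by
      rw [integrableOn_indicator_iff measurableSet_Ioi, Ioi_inter_Iic]
      exact hint b
    exact this.mono_set fun x hx => hb hx
  rw [EventuallyEq, ae_restrict_iff' measurableSet_Ioi]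
  -- By Lebesgue differentiation the primitive has derivative `h x` at almost every `x`; being
  -- locally constant, it also has derivative 0.
  filter_upwards [LocallyIntegrable.ae_hasDerivAt_integral hloc] with x hx hx0
  have h1 := hx 0
  have h2 : HasDerivAt (fun y : ℝ => ∫ t in (0 : ℝ)..y, (Ioi 0).indicator h t) 0 x := by
    refine (hasDerivAt_const x (0 : ℝ)).congr_of_eventuallyEq ?_
    filter_upwards [lt_mem_nhds (show (0 : ℝ) < x from hx0)] with y hy
    rw [intervalIntegral.integral_of_le hy.le]
    refine Eq.trans ?_ (h0 ⟨y, hy.le⟩)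
    refine setIntegral_congr_fun (measurableSet_Ioc (a := (0 : ℝ)) (b := y)) fun t ht => ?_
    exact indicator_of_mem (show t ∈ Ioi (0 : ℝ) from ht.1) _
  have := h1.unique h2
  rwa [indicator_of_mem hx0] at this

theorem memLp_indicator_Ioc (b : ℝ≥0) :
    MemLp ((Ioc 0 (b : ℝ)).indicator (1 : ℝ → ℝ)) 2 (volume.restrict (Ioi 0)) :=
  memLp_indicator_const (c := (1 : ℝ)) 2 measurableSet_Ioc (Or.inr (by
    refine ne_top_of_le_ne_top ?_ (Measure.restrict_apply_le _ _)
    simp))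

theorem inner_indicator_Ioc {g : ℝ → ℝ} (b : ℝ≥0) :
    ∫ s in Ioi 0, (Ioc 0 (b : ℝ)).indicator (1 : ℝ → ℝ) s * g s = ∫ s in Ioc 0 (b : ℝ), g s := by
  have : ∀ s, (Ioc 0 (b : ℝ)).indicator (1 : ℝ → ℝ) s * g s = (Ioc 0 (b : ℝ)).indicator g s := by
    intro s
    by_cases hs : s ∈ Ioc 0 (b : ℝ) <;> simp [hs]
  simp only [this]
  rw [setIntegral_indicator measurableSet_Ioc, inter_eq_self_of_subset_right Ioc_subset_Ioi_self]

theorem memLp_stepFun (c : ℝ≥0 →₀ ℝ) : MemLp (stepFun c) 2 (volume.restrict (Ioi 0)) :=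
  memLp_finsuppSum memLp_indicator_Ioc c

/-- The step functions are dense in `L²(0, ∞)`. -/
theorem exists_tendsto_stepFun {f : ℝ → ℝ} (hf : MemLp f 2 (volume.restrict (Ioi 0))) :
    ∃ φ : ℕ → (ℝ≥0 →₀ ℝ),
      Tendsto (fun n => (memLp_stepFun (φ n)).toLp _) atTop (𝓝 (hf.toLp f)) := by
  let v : ℝ≥0 → Lp ℝ 2 (volume.restrict (Ioi (0 : ℝ))) := fun b => (memLp_indicator_Ioc b).toLp _
  have hd : (LinearMap.range (Finsupp.linearCombination ℝ v)).topologicalClosure = ⊤ := by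
    -- Density amounts to a trivial orthogonal complement; orthogonality to the indicators of (0, b]
    -- means that the primitive vanishes.
    rw [Submodule.topologicalClosure_eq_top_iff, Submodule.eq_bot_iff]
    intro h hh
    have h0 : ∀ b : ℝ≥0, ∫ s in Ioc 0 (b : ℝ), h s = 0 := fun b => by
      have := hh (v b) ⟨Finsupp.single b 1, by simp⟩
      rw [← Lp.toLp_coeFn h (Lp.memLp h), inner_toLp, inner_indicator_Ioc] at this
      exact this
    have := ae_eq_zero_of_setIntegral_Ioc_eq_zero (Lp.memLp h) h0
    exact (Lp.eq_zero_iff_ae_eq_zero).2 this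
  have hmem : hf.toLp f ∈ closure (range (Finsupp.linearCombination ℝ v)) := by
    have : hf.toLp f ∈ (LinearMap.range (Finsupp.linearCombination ℝ v)).topologicalClosure := by
      rw [hd]; trivial
    rwa [← SetLike.mem_coe, Submodule.topologicalClosure_coe, LinearMap.coe_range] at this
  obtain ⟨x, hx, hlim⟩ := mem_closure_iff_seq_limit.1 hmem
  choose φ hφ using hx
  refine ⟨φ, hlim.congr fun n => ?_⟩
  rw [← hφ n]
  exact (toLp_finsuppSum memLp_indicator_Ioc (φ n)).symm

/-! ### The Wiener isometry and the correlation of Wiener integrals -/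

section Probability

variable {Ω : Type*} [MeasurableSpace Ω] {P : Measure Ω} [IsProbabilityMeasure P]
  {W : ℝ≥0 → Ω → ℝ}

omit [IsProbabilityMeasure P] in
theorem memLp_increment (hW : IsBrownianReal W P) (b : ℝ≥0) :
    MemLp (fun ω => W b ω - W 0 ω) 2 P :=
  (hW.isGaussianProcess.hasGaussianLaw_eval b).memLp_two.sub
    (hW.isGaussianProcess.hasGaussianLaw_eval 0).memLp_two

omit [IsProbabilityMeasure P] in
theorem integral_increment (hW : IsBrownianReal W P) (b : ℝ≥0) :
    ∫ ω, (W b ω - W 0 ω) ∂P = 0 := by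
  rw [integral_sub (hW.integrable_eval b) (hW.integrable_eval 0), hW.integral_eval,
    hW.integral_eval, sub_zero]

theorem integral_increment_mul_increment (hW : IsBrownianReal W P) (a b : ℝ≥0) :
    ∫ ω, (W a ω - W 0 ω) * (W b ω - W 0 ω) ∂P = (min a b : ℝ≥0) := by
  have h2 : ∀ t, MemLp (W t) 2 P := fun t =>
    (hW.isGaussianProcess.hasGaussianLaw_eval t).memLp_two
  have h := hW.covariance_eval a b
  rw [covariance_eq_sub (h2 a) (h2 b), hW.integral_eval, hW.integral_eval, mul_zero, sub_zero] at h
  rw [← h]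
  refine integral_congr_ae ?_
  -- `W 0` vanishes almost surely, so increments from time 0 have the covariance of `W` itself.
  filter_upwards [hW.eval_zero_ae_eq_zero] with ω hω
  simp [hω]

omit [IsProbabilityMeasure P] in
theorem memLp_stepIntegral (hW : IsBrownianReal W P) (c : ℝ≥0 →₀ ℝ) :
    MemLp (stepIntegral W c) 2 P :=
  memLp_finsuppSum (memLp_increment hW) c

/-- The isometry of the elementary Wiener integral. -/
theorem inner_stepIntegral (hW : IsBrownianReal W P) (c d : ℝ≥0 →₀ ℝ) :
    inner ℝ ((memLp_stepIntegral hW c).toLp _) ((memLp_stepIntegral hW d).toLp _) =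
      inner ℝ ((memLp_stepFun c).toLp _) ((memLp_stepFun d).toLp _) := by
  have key : ∀ a b : ℝ≥0,
      inner ℝ ((memLp_increment hW a).toLp _) ((memLp_increment hW b).toLp _) =
        inner ℝ ((memLp_indicator_Ioc a).toLp _) ((memLp_indicator_Ioc b).toLp _) := by
    intro a b
    rw [inner_toLp, inner_toLp, integral_increment_mul_increment hW, inner_indicator_Ioc]
    rw [setIntegral_indicator measurableSet_Ioc, Ioc_inter_Ioc]
    simp
  refine (congrArg₂ (inner ℝ) (toLp_finsuppSum (memLp_increment hW) c)
    (toLp_finsuppSum (memLp_increment hW) d)).trans (Eq.trans ?_ (congrArg₂ (inner ℝ)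
    (toLp_finsuppSum memLp_indicator_Ioc c) (toLp_finsuppSum memLp_indicator_Ioc d)).symm)
  rw [inner_linearCombination, inner_linearCombination]
  simp only [key]

omit [IsProbabilityMeasure P] in
theorem IsWienerIntegral.exists_tendsto (hW : IsBrownianReal W P) {f : ℝ → ℝ} {Y : Ω → ℝ}
    (h : IsWienerIntegral W P f Y) :
    ∃ φ : ℕ → (ℝ≥0 →₀ ℝ),
      Tendsto (fun n => (memLp_stepFun (φ n)).toLp _) atTop (𝓝 (h.1.toLp f)) ∧
      Tendsto (fun n => (memLp_stepIntegral hW (φ n)).toLp _) atTop (𝓝 (h.2.1.toLp Y)) := by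
  obtain ⟨hf, hY, φ, h1, h2⟩ := h
  exact ⟨φ, (Lp.tendsto_Lp_iff_tendsto_eLpNorm'' _ _ _ _).2 h1,
    (Lp.tendsto_Lp_iff_tendsto_eLpNorm'' _ _ _ _).2 h2⟩

theorem exists_isWienerIntegral (hW : IsBrownianReal W P) {f : ℝ → ℝ}
    (hf : MemLp f 2 (volume.restrict (Ioi 0))) : ∃ Y, IsWienerIntegral W P f Y := by
  obtain ⟨φ, hφ⟩ := exists_tendsto_stepFun hf
  -- Inner products determine distances, so the elementary integrals are Cauchy along with the step
  -- functions, and completeness of L²(P) supplies the limit.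
  have hdist : ∀ c d : ℝ≥0 →₀ ℝ,
      dist ((memLp_stepIntegral hW c).toLp _) ((memLp_stepIntegral hW d).toLp _) =
        dist ((memLp_stepFun c).toLp _) ((memLp_stepFun d).toLp _) := by
    intro c d
    rw [dist_eq_norm, dist_eq_norm, ← sq_eq_sq₀ (norm_nonneg _) (norm_nonneg _),
      norm_sub_sq_real, norm_sub_sq_real]
    simp only [← real_inner_self_eq_norm_sq, inner_stepIntegral hW]
  have hc : CauchySeq fun n => (memLp_stepIntegral hW (φ n)).toLp _ := by
    have := hφ.cauchySeq
    rw [Metric.cauchySeq_iff] at this ⊢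
    simpa only [hdist] using this
  obtain ⟨Y, hY⟩ := cauchySeq_tendsto_of_complete hc
  refine ⟨Y, hf, Lp.memLp Y, φ, (Lp.tendsto_Lp_iff_tendsto_eLpNorm'' _ _ _ _).1 hφ, ?_⟩
  refine (Lp.tendsto_Lp_iff_tendsto_eLpNorm'' (fun n => stepIntegral W (φ n))
    (fun n => memLp_stepIntegral hW (φ n)) Y (Lp.memLp Y)).1 ?_
  rwa [Lp.toLp_coeFn]

theorem isWienerIntegral_wienerIntegral (hW : IsBrownianReal W P) {f : ℝ → ℝ}
    (hf : MemLp f 2 (volume.restrict (Ioi 0))) :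
    IsWienerIntegral W P f (wienerIntegral W P f) := by
  have h := exists_isWienerIntegral hW hf
  rw [wienerIntegral, dif_pos h]
  exact h.choose_spec

/-- The isometry passes to the limit by continuity of the inner product. Any approximating sequences
will do, so the arbitrary choice in `wienerIntegral` is harmless. -/
theorem IsWienerIntegral.integral_mul (hW : IsBrownianReal W P) {f g : ℝ → ℝ} {Y Z : Ω → ℝ}
    (hY : IsWienerIntegral W P f Y) (hZ : IsWienerIntegral W P g Z) :
    ∫ ω, Y ω * Z ω ∂P = ∫ s in Ioi 0, f s * g s := by
  obtain ⟨φ, h1, h2⟩ := hY.exists_tendsto hW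
  obtain ⟨ψ, h3, h4⟩ := hZ.exists_tendsto hW
  rw [← inner_toLp hY.1 hZ.1, ← inner_toLp hY.2.1 hZ.2.1]
  refine tendsto_nhds_unique (h2.inner h4) ?_
  simp only [inner_stepIntegral hW]
  exact h1.inner h3

/-- The mean is the inner product with the constant 1, hence continuous on L²(P), and it vanishes on
elementary integrals. -/
theorem IsWienerIntegral.integral_eq_zero (hW : IsBrownianReal W P) {f : ℝ → ℝ} {Y : Ω → ℝ}
    (hY : IsWienerIntegral W P f Y) : ∫ ω, Y ω ∂P = 0 := by
  obtain ⟨φ, -, h2⟩ := hY.exists_tendsto hW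
  have h1 : MemLp (fun _ : Ω => (1 : ℝ)) 2 P := memLp_const 1
  have h3 := (tendsto_const_nhds (x := h1.toLp _)).inner (𝕜 := ℝ) h2
  simp only [inner_toLp, one_mul] at h3
  refine tendsto_nhds_unique h3 (tendsto_const_nhds.congr fun n => ?_)
  simp only [stepIntegral, Finsupp.sum]
  rw [integral_finsetSum _ fun b _ =>
    ((memLp_increment hW b).integrable one_le_two).const_mul _]
  simp [integral_const_mul, integral_increment hW]

theorem IsWienerIntegral.covariance_eq (hW : IsBrownianReal W P) {f g : ℝ → ℝ} {Y Z : Ω → ℝ}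
    (hY : IsWienerIntegral W P f Y) (hZ : IsWienerIntegral W P g Z) :
    covariance Y Z P = ∫ s in Ioi 0, f s * g s := by
  rw [covariance_eq_sub hY.2.1 hZ.2.1, hY.integral_eq_zero hW, zero_mul, sub_zero,
    ← hY.integral_mul hW hZ]
  rfl

/-- The correlation of a Wiener integral and an increment of Wiener integrals. -/
theorem corr_sub_eq (hW : IsBrownianReal W P) {f g h : ℝ → ℝ} {U Y Z : Ω → ℝ}
    (hf : MemLp f 2 (volume.restrict (Ioi 0))) (hg : MemLp g 2 (volume.restrict (Ioi 0)))
    (hh : MemLp h 2 (volume.restrict (Ioi 0)))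
    (hU : U =ᵐ[P] wienerIntegral W P f) (hY : Y =ᵐ[P] wienerIntegral W P g)
    (hZ : Z =ᵐ[P] wienerIntegral W P h) :
    corr U (Y - Z) P = (∫ s in Ioi 0, f s * (g s - h s)) /
      (√(∫ s in Ioi 0, f s ^ 2) * √(∫ s in Ioi 0, (g s - h s) ^ 2)) := by
  have kf := isWienerIntegral_wienerIntegral hW hf
  have kg := isWienerIntegral_wienerIntegral hW hg
  have kh := isWienerIntegral_wienerIntegral hW hh
  have mU : MemLp U 2 P := kf.2.1.ae_eq hU.symm
  have mY : MemLp Y 2 P := kg.2.1.ae_eq hY.symm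
  have mZ : MemLp Z 2 P := kh.2.1.ae_eq hZ.symm
  have cc : ∀ {U₁ U₂ V₁ V₂ : Ω → ℝ}, U₁ =ᵐ[P] U₂ → V₁ =ᵐ[P] V₂ →
      covariance U₁ V₁ P = covariance U₂ V₂ P := by
    intro U₁ U₂ V₁ V₂ h1 h2
    rw [covariance, covariance, integral_congr_ae h1, integral_congr_ae h2]
    refine integral_congr_ae ?_
    filter_upwards [h1, h2] with ω a b
    rw [a, b]
  have i1 : Integrable (fun s => f s * g s) (volume.restrict (Ioi 0)) := hf.integrable_mul hg
  have i2 : Integrable (fun s => f s * h s) (volume.restrict (Ioi 0)) := hf.integrable_mul hh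
  have i3 : Integrable (fun s => g s * g s) (volume.restrict (Ioi 0)) := hg.integrable_mul hg
  have i4 : Integrable (fun s => g s * h s) (volume.restrict (Ioi 0)) := hg.integrable_mul hh
  have i5 : Integrable (fun s => h s * g s) (volume.restrict (Ioi 0)) := hh.integrable_mul hg
  have i6 : Integrable (fun s => h s * h s) (volume.restrict (Ioi 0)) := hh.integrable_mul hh
  have e1 : covariance U (Y - Z) P = ∫ s in Ioi 0, f s * (g s - h s) := by
    rw [covariance_sub_right mU mY mZ, cc hU hY, cc hU hZ, kf.covariance_eq hW kg,
      kf.covariance_eq hW kh, ← integral_sub i1 i2]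
    simp only [mul_sub]
  have e2 : variance U P = ∫ s in Ioi 0, f s ^ 2 := by
    rw [← covariance_self mU.aemeasurable, cc hU hU, kf.covariance_eq hW kf]
    simp only [sq]
  have e3 : variance (Y - Z) P = ∫ s in Ioi 0, (g s - h s) ^ 2 := by
    rw [← covariance_self (mY.sub mZ).aemeasurable, covariance_sub_sub mY mZ mY mZ, cc hY hY,
      cc hY hZ, cc hZ hY, cc hZ hZ, kg.covariance_eq hW kg, kg.covariance_eq hW kh,
      kh.covariance_eq hW kg, kh.covariance_eq hW kh]
    have : ∀ s, (g s - h s) ^ 2 = g s * g s - g s * h s - h s * g s + h s * h s := fun s => by ring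
    simp only [this]
    rw [integral_add (by exact (i3.sub i4).sub i5) i6, integral_sub (by exact i3.sub i4) i5,
      integral_sub i3 i4]
  rw [corr, e1, e2, e3]

end Probability

/-! ### Integrability and measurability of the Volterra kernel -/

section Kernel

variable {α β γ : ℝ}

theorem intervalIntegrable_sub_rpow (hγ : -1 < γ) (s a b : ℝ) :
    IntervalIntegrable (fun u => (u - s) ^ γ) volume a b := by
  simpa using (intervalIntegral.intervalIntegrable_rpow' hγ (a := a - s)
    (b := b - s)).comp_sub_right s

theorem intervalIntegrable_rpow_mul_sub_rpow (hγ : -1 < γ) {a b : ℝ} (s : ℝ) (ha : 0 < a)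
    (hab : a ≤ b) : IntervalIntegrable (fun u => u ^ β * (u - s) ^ γ) volume a b := by
  refine (intervalIntegrable_sub_rpow hγ s a b).continuousOn_mul ?_
  rw [uIcc_of_le hab]
  exact fun u hu => (Real.continuousAt_rpow_const _ _
    (Or.inl (ha.trans_le hu.1).ne')).continuousWithinAt

theorem integral_sub_rpow (hγ : -1 < γ) (s a b : ℝ) :
    ∫ u in a..b, (u - s) ^ γ = ((b - s) ^ (γ + 1) - (a - s) ^ (γ + 1)) / (γ + 1) := by
  rw [intervalIntegral.integral_comp_sub_right (fun u => u ^ γ) s, integral_rpow (Or.inl hγ)]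

theorem integral_rpow_mul_sub_rpow_pos (hγ : -1 < γ) {s a b : ℝ} (ha : 0 < a) (hsa : s ≤ a)
    (hab : a < b) : 0 < ∫ u in a..b, u ^ β * (u - s) ^ γ :=
  intervalIntegral.intervalIntegral_pos_of_pos_on
    (intervalIntegrable_rpow_mul_sub_rpow hγ s ha hab.le)
    (fun u hu => mul_pos (Real.rpow_pos_of_pos (ha.trans hu.1) _)
      (Real.rpow_pos_of_pos (by linarith [hu.1]) _)) hab

theorem kernel_of_mem {s t : ℝ} (hs : 0 < s) (hst : s < t) :
    kernel α β γ t s = s ^ α * ∫ u in s..t, u ^ β * (u - s) ^ γ :=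
  indicator_of_mem (show s ∈ Ioo 0 t from ⟨hs, hst⟩) _

theorem kernel_of_le {s t : ℝ} (hst : t ≤ s) : kernel α β γ t s = 0 :=
  indicator_of_notMem (fun h : s ∈ Ioo 0 t => absurd h.2 hst.not_gt) _

theorem kernel_pos (hγ : -1 < γ) {s t : ℝ} (hs : 0 < s) (hst : s < t) :
    0 < kernel α β γ t s := by
  rw [kernel_of_mem hs hst]
  exact mul_pos (Real.rpow_pos_of_pos hs _) (integral_rpow_mul_sub_rpow_pos hγ hs le_rfl hst)

theorem kernel_nonneg (hγ : -1 < γ) (s t : ℝ) : 0 ≤ kernel α β γ t s := by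
  by_cases h : s ∈ Ioo 0 t
  · exact (kernel_pos hγ h.1 h.2).le
  · exact (indicator_of_notMem h _).ge

/-- The kernel is dominated by a power of `s`. -/
theorem kernel_le {p : ℝ} (hγ : -1 < γ) (hp : 0 ≤ p) (hpγ : -1 < β + γ + p) (t : ℝ) :
    ∃ C, 0 ≤ C ∧ ∀ s, 0 < s → kernel α β γ t s ≤ C * s ^ (α - p) := by
  -- Split u^β into u^(-p), u^(max (β+p) 0) and u^(min (β+p) 0). The first is at most s^(-p), the
  -- second at most its value at t, and the third, having a nonpositive exponent, is absorbed into
  -- the power of u - s, which stays integrable as δ > -1.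
  set δ := γ + min (β + p) 0 with hδ
  have hδ1 : -1 < δ := by rcases min_cases (β + p) 0 with h | h <;> linarith [h.1]
  rcases le_or_gt t 0 with ht | ht
  · exact ⟨0, le_rfl, fun s hs => by rw [kernel_of_le (ht.trans hs.le), zero_mul]⟩
  refine ⟨t ^ max (β + p) 0 * (t ^ (δ + 1) / (δ + 1)), ?_, fun s hs => ?_⟩
  · have : 0 < δ + 1 := by linarith
    positivity
  rcases le_or_gt t s with hst | hst
  · rw [kernel_of_le hst]
    have : 0 < δ + 1 := by linarith
    positivity
  have hmono : ∫ u in s..t, u ^ β * (u - s) ^ γ ≤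
      ∫ u in s..t, s ^ (-p) * t ^ max (β + p) 0 * (u - s) ^ δ := by
    refine intervalIntegral.integral_mono_on_of_le_Ioo hst.le
      (intervalIntegrable_rpow_mul_sub_rpow hγ s hs hst.le)
      ((intervalIntegrable_sub_rpow hδ1 s s t).const_mul _) fun u hu => ?_
    have hu0 : 0 < u := hs.trans hu.1
    have hus : 0 < u - s := sub_pos.2 hu.1
    have e1 : u ^ β = u ^ (-p) * (u ^ max (β + p) 0 * u ^ min (β + p) 0) := by
      rw [← Real.rpow_add hu0, ← Real.rpow_add hu0, max_add_min]
      congr 1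
      ring
    have e2 : (u - s) ^ δ = (u - s) ^ γ * (u - s) ^ min (β + p) 0 := by
      rw [← Real.rpow_add hus]
    have h1 : u ^ (-p) ≤ s ^ (-p) := Real.rpow_le_rpow_of_nonpos hs hu.1.le (by linarith)
    have h2 : u ^ max (β + p) 0 ≤ t ^ max (β + p) 0 :=
      Real.rpow_le_rpow hu0.le hu.2.le (le_max_right _ _)
    have h3 : u ^ min (β + p) 0 ≤ (u - s) ^ min (β + p) 0 :=
      Real.rpow_le_rpow_of_nonpos hus (by linarith) (min_le_right _ _)
    calc u ^ β * (u - s) ^ γ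
        = u ^ (-p) * (u ^ max (β + p) 0 * u ^ min (β + p) 0) * (u - s) ^ γ := by rw [e1]
      _ ≤ s ^ (-p) * (t ^ max (β + p) 0 * (u - s) ^ min (β + p) 0) * (u - s) ^ γ := by gcongr
      _ = s ^ (-p) * t ^ max (β + p) 0 * (u - s) ^ δ := by rw [e2]; ring
  rw [kernel_of_mem hs hst]
  rw [intervalIntegral.integral_const_mul, integral_sub_rpow hδ1, sub_self,
    Real.zero_rpow (by linarith), sub_zero] at hmono
  have hts : (t - s) ^ (δ + 1) ≤ t ^ (δ + 1) :=
    Real.rpow_le_rpow (by linarith) (by linarith) (by linarith)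
  have hδ2 : 0 < δ + 1 := by linarith
  calc s ^ α * ∫ u in s..t, u ^ β * (u - s) ^ γ
      ≤ s ^ α * (s ^ (-p) * t ^ max (β + p) 0 * ((t - s) ^ (δ + 1) / (δ + 1))) := by gcongr
    _ ≤ s ^ α * (s ^ (-p) * t ^ max (β + p) 0 * (t ^ (δ + 1) / (δ + 1))) := by gcongr
    _ = _ := by rw [sub_eq_add_neg α p, Real.rpow_add hs]; ring

/-- Joint measurability is what makes the correlation measurable in t, as the integral statements
require. -/
theorem measurable_kernel : Measurable fun x : ℝ × ℝ => kernel α β γ x.1 x.2 := by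
  have h1 : StronglyMeasurable fun x : ℝ × ℝ => ∫ u : ℝ, ({y : (ℝ × ℝ) × ℝ | y.1.2 < y.2 ∧
      y.2 ≤ y.1.1}.indicator fun y => y.2 ^ β * (y.2 - y.1.2) ^ γ) (x, u) := by
    refine StronglyMeasurable.integral_prod_right' (ν := (volume : Measure ℝ)) ?_
    refine Measurable.stronglyMeasurable (Measurable.indicator (by fun_prop) ?_)
    exact (measurableSet_lt (measurable_snd.comp measurable_fst) measurable_snd).inter
      (measurableSet_le measurable_snd (measurable_fst.comp measurable_fst))
  have h2 : (fun x : ℝ × ℝ => kernel α β γ x.1 x.2) =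
      {x : ℝ × ℝ | 0 < x.2 ∧ x.2 < x.1}.indicator fun x => x.2 ^ α *
        ∫ u : ℝ, ({y : (ℝ × ℝ) × ℝ | y.1.2 < y.2 ∧
          y.2 ≤ y.1.1}.indicator fun y => y.2 ^ β * (y.2 - y.1.2) ^ γ) (x, u) := by
    funext ⟨t, s⟩
    by_cases h : 0 < s ∧ s < t
    · rw [indicator_of_mem (by exact h), kernel_of_mem h.1 h.2,
        intervalIntegral.integral_of_le h.2.le, ← integral_indicator measurableSet_Ioc]
      rfl
    · rw [indicator_of_notMem (by exact h)]
      exact indicator_of_notMem (by exact h) _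
  rw [h2]
  refine Measurable.indicator ?_ ?_
  · exact (measurable_snd.pow_const α).mul h1.measurable
  · exact (measurableSet_lt measurable_const measurable_snd).inter
      (measurableSet_lt measurable_snd measurable_fst)

theorem measurable_kernel_right (t : ℝ) : Measurable (kernel α β γ t) :=
  measurable_kernel.comp (measurable_const.prodMk measurable_id)

/-- Such a p makes the bound s^(α-p) of `kernel_le` square-integrable at 0. The constraints max(0,
-1-β-γ) < p < α + 1/2 are compatible exactly under the two hypotheses. -/
theorem exists_exponent (hα : -(1 / 2) < α) (hαβγ : -(3 / 2) < α + β + γ) :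
    ∃ p, 0 ≤ p ∧ -1 < β + γ + p ∧ -(1 / 2) < α - p := by
  obtain ⟨p, h1, h2⟩ := exists_between
    (show max 0 (-1 - β - γ) < α + 1 / 2 from max_lt (by linarith) (by linarith))
  rw [max_lt_iff] at h1
  exact ⟨p, h1.1.le, by linarith, by linarith⟩

theorem integrableOn_Ioo_rpow {e : ℝ} (he : -1 < e) (t : ℝ) :
    IntegrableOn (fun s : ℝ => s ^ e) (Ioo 0 t) :=
  ((intervalIntegral.intervalIntegrable_rpow' he).1).mono_set Ioo_subset_Ioc_self

theorem memLp_kernel (hα : -(1 / 2) < α) (hγ : -1 < γ) (hαβγ : -(3 / 2) < α + β + γ) (t : ℝ) :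
    MemLp (kernel α β γ t) 2 (volume.restrict (Ioi 0)) := by
  obtain ⟨p, hp, hpγ, hpα⟩ := exists_exponent hα hαβγ
  obtain ⟨C, hC, hle⟩ := kernel_le (α := α) hγ hp hpγ t
  rw [memLp_two_iff_integrable_sq (measurable_kernel_right t).aestronglyMeasurable]
  have hsub : Ioo 0 t ⊆ Ioi (0 : ℝ) := fun s hs => hs.1
  have hI : IntegrableOn (fun s => kernel α β γ t s ^ 2) (Ioo 0 t) := by
    refine Integrable.mono' ((integrableOn_Ioo_rpow (e := 2 * (α - p)) (by linarith) t).const_mul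
      (C ^ 2)) ((measurable_kernel_right t).pow_const 2).aestronglyMeasurable ?_
    refine (ae_restrict_mem measurableSet_Ioo).mono fun s hs => ?_
    rw [Real.norm_of_nonneg (sq_nonneg _)]
    calc kernel α β γ t s ^ 2 ≤ (C * s ^ (α - p)) ^ 2 :=
          pow_le_pow_left₀ (kernel_nonneg hγ s t) (hle s hs.1) 2
      _ = C ^ 2 * s ^ (2 * (α - p)) := by
          rw [mul_pow, ← Real.rpow_natCast (s ^ (α - p)), ← Real.rpow_mul hs.1.le]
          congr 2
          push_cast
          ring
  refine hI.of_forall_sdiff_eq_zero measurableSet_Ioi fun s hs => ?_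
  rw [kernel_of_le (not_lt.1 fun h => hs.2 ⟨hs.1, h⟩), zero_pow two_ne_zero]

theorem integrableOn_kernel_mul_rpow (hα : -(1 / 2) < α) (hγ : -1 < γ)
    (hαβγ : -(3 / 2) < α + β + γ) (t : ℝ) :
    IntegrableOn (fun s => kernel α β γ t s * s ^ α) (Ioo 0 t) := by
  obtain ⟨p, hp, hpγ, hpα⟩ := exists_exponent hα hαβγ
  obtain ⟨C, hC, hle⟩ := kernel_le (α := α) hγ hp hpγ t
  refine Integrable.mono' ((integrableOn_Ioo_rpow (e := α - p + α) (by linarith) t).const_mul C)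
    ((measurable_kernel_right t).mul (measurable_id.pow_const α)).aestronglyMeasurable ?_
  refine (ae_restrict_mem measurableSet_Ioo).mono fun s hs => ?_
  rw [Real.norm_of_nonneg (mul_nonneg (kernel_nonneg hγ s t) (Real.rpow_nonneg hs.1.le _)),
    Real.rpow_add hs.1, ← mul_assoc]
  exact mul_le_mul_of_nonneg_right (hle s hs.1) (Real.rpow_nonneg hs.1.le _)

/-- The increments of the kernel. -/
theorem kernel_sub_kernel (hγ : -1 < γ) {s t : ℝ} (hs : 0 < s) (hst : s < t + 1) :
    kernel α β γ (t + 1) s - kernel α β γ t s =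
      s ^ α * ∫ u in max s t..t + 1, u ^ β * (u - s) ^ γ := by
  rw [kernel_of_mem hs hst]
  rcases le_or_gt t s with h | h
  · rw [kernel_of_le h, max_eq_left h, sub_zero]
  · rw [kernel_of_mem hs h, max_eq_right h.le, ← mul_sub,
      intervalIntegral.integral_interval_sub_left
        (intervalIntegrable_rpow_mul_sub_rpow hγ s hs hst.le)
        (intervalIntegrable_rpow_mul_sub_rpow hγ s hs h.le)]

/-- A power is monotone in one direction or the other; using |e| gives one two-sided bound for both
signs. -/
theorem rpow_mem_Icc {t r x : ℝ} (e : ℝ) (ht : 0 < t) (hr : 1 ≤ r) (h1 : t / r ≤ x)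
    (h2 : x ≤ t * r) : x ^ e ∈ Icc (t ^ e * r ^ (-|e|)) (t ^ e * r ^ |e|) := by
  have hr0 : 0 < r := by linarith
  have hx : 0 < x := (div_pos ht hr0).trans_le h1
  have hle : r ^ (-|e|) ≤ r ^ |e| :=
    Real.rpow_le_rpow_of_exponent_le hr (by linarith [abs_nonneg e])
  rcases le_total 0 e with he | he
  · rw [abs_of_nonneg he, Real.rpow_neg hr0.le, ← div_eq_mul_inv, ← Real.div_rpow ht.le hr0.le,
      ← Real.mul_rpow ht.le hr0.le]
    exact ⟨Real.rpow_le_rpow (by positivity) h1 he, Real.rpow_le_rpow hx.le h2 he⟩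
  · rw [abs_of_nonpos he, neg_neg, Real.rpow_neg hr0.le, ← div_eq_mul_inv,
      ← Real.div_rpow ht.le hr0.le, ← Real.mul_rpow ht.le hr0.le]
    exact ⟨Real.rpow_le_rpow_of_nonpos hx h2 he,
      Real.rpow_le_rpow_of_nonpos (by positivity) h1 he⟩

end Kernel

/-! ### Reduction of covariance and variance to one-variable integrals -/

section Sandwich

variable {α β γ : ℝ}

theorem one_le_div_sub_one {t : ℝ} (ht : 2 ≤ t) : 1 ≤ t / (t - 1) := by
  rw [le_div_iff₀ (by linarith)]
  linarith

theorem add_one_le_mul_div_sub_one {t : ℝ} (ht : 2 ≤ t) : t + 1 ≤ t * (t / (t - 1)) := by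
  rw [← mul_div_assoc, le_div_iff₀ (by linarith)]
  nlinarith

/-- The ratio r = t / (t - 1) satisfies t / r = t - 1 and t r ≥ t + 1, and it tends to 1. -/
theorem rpow_mem_Icc_of_mem {t x : ℝ} (e : ℝ) (ht : 2 ≤ t) (hx : x ∈ Icc (t - 1) (t + 1)) :
    x ^ e ∈ Icc (t ^ e * (t / (t - 1)) ^ (-|e|)) (t ^ e * (t / (t - 1)) ^ |e|) := by
  refine rpow_mem_Icc e (by linarith) (one_le_div_sub_one ht) ?_
    (hx.2.trans (add_one_le_mul_div_sub_one ht))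
  rw [div_div_cancel₀ (by linarith)]
  exact hx.1

theorem tendsto_div_sub_one_rpow (e : ℝ) :
    Tendsto (fun t : ℝ => (t / (t - 1)) ^ e) atTop (𝓝 1) := by
  have h1 : Tendsto (fun t : ℝ => 1 + (t - 1)⁻¹) atTop (𝓝 1) := by
    simpa [sub_eq_add_neg] using (tendsto_inv_atTop_zero.comp
      (tendsto_atTop_add_const_right atTop (-1 : ℝ) tendsto_id)).const_add (1 : ℝ)
  have h2 : Tendsto (fun t : ℝ => t / (t - 1)) atTop (𝓝 1) := by
    refine h1.congr' ?_
    filter_upwards [eventually_gt_atTop 1] with t ht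
    have : t - 1 ≠ 0 := by linarith
    field_simp
    ring
  simpa using h2.rpow_const (p := e) (Or.inl one_ne_zero)

/-- A squeeze lemma up to a factor that tends to one. -/
theorem tendsto_div_of_mem_Icc {f a B ψ : ℝ → ℝ} {L : ℝ} (N : ℝ)
    (ha : ∀ᶠ t in atTop, 0 < a t) (hψ : ∀ᶠ t in atTop, 0 < ψ t)
    (hB : Tendsto (fun t => B t / ψ t) atTop (𝓝 L))
    (hf : ∀ t, 2 ≤ t → f t ∈ Icc (a t * (t / (t - 1)) ^ (-N) * B t)
      (a t * (t / (t - 1)) ^ N * B t)) :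
    Tendsto (fun t => f t / (a t * ψ t)) atTop (𝓝 L) := by
  have h1 := (tendsto_div_sub_one_rpow (-N)).mul hB
  have h2 := (tendsto_div_sub_one_rpow N).mul hB
  rw [one_mul] at h1 h2
  refine tendsto_of_tendsto_of_tendsto_of_le_of_le' h1 h2 ?_ ?_
  · filter_upwards [ha, hψ, eventually_ge_atTop 2] with t h3 h4 h5
    rw [le_div_iff₀ (mul_pos h3 h4)]
    refine Eq.trans_le ?_ (hf t h5).1
    field_simp
  · filter_upwards [ha, hψ, eventually_ge_atTop 2] with t h3 h4 h5
    rw [div_le_iff₀ (mul_pos h3 h4)]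
    refine (hf t h5).2.trans_eq ?_
    field_simp

theorem setIntegral_kernel_mul {t : ℝ} (F : ℝ → ℝ) :
    ∫ s in Ioi 0, kernel α β γ t s * F s = ∫ s in Ioo 0 t, kernel α β γ t s * F s := by
  refine setIntegral_eq_of_subset_of_forall_sdiff_eq_zero measurableSet_Ioi
    (fun s hs => hs.1) fun s hs => ?_
  rw [kernel_of_le (not_lt.1 fun h => hs.2 ⟨hs.1, h⟩), zero_mul]

theorem integral_kernel_mul_rpow_pos (hα : -(1 / 2) < α) (hγ : -1 < γ)
    (hαβγ : -(3 / 2) < α + β + γ) : 0 < ∫ s in Ioo 0 1, kernel α β γ 1 s * s ^ α := by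
  have hpos : ∀ s ∈ Ioo (0 : ℝ) 1, 0 < kernel α β γ 1 s * s ^ α := fun s hs =>
    mul_pos (kernel_pos hγ hs.1 hs.2) (Real.rpow_pos_of_pos hs.1 _)
  have h := intervalIntegral.intervalIntegral_pos_of_pos_on
    ((intervalIntegrable_iff_integrableOn_Ioo_of_le zero_le_one).2
      (integrableOn_kernel_mul_rpow hα hγ hαβγ 1)) hpos one_pos
  rwa [intervalIntegral.integral_of_le zero_le_one, integral_Ioc_eq_integral_Ioo] at h

theorem integral_kernel_sq_pos (hα : -(1 / 2) < α) (hγ : -1 < γ)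
    (hαβγ : -(3 / 2) < α + β + γ) : 0 < ∫ s in Ioi 0, kernel α β γ 1 s ^ 2 := by
  have hpos : ∀ s ∈ Ioo (0 : ℝ) 1, 0 < kernel α β γ 1 s ^ 2 := fun s hs =>
    pow_pos (kernel_pos hγ hs.1 hs.2) 2
  have h := intervalIntegral.intervalIntegral_pos_of_pos_on
    ((intervalIntegrable_iff_integrableOn_Ioo_of_le zero_le_one).2
      ((memLp_kernel hα hγ hαβγ 1).integrable_sq.mono_measure
        (Measure.restrict_mono (fun s hs => hs.1) le_rfl))) hpos one_pos
  rw [intervalIntegral.integral_of_le zero_le_one, integral_Ioc_eq_integral_Ioo] at h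
  simp only [sq] at h ⊢
  rwa [setIntegral_kernel_mul]

/-- The asymptotics of the covariance of `X_1` and `X_{t+1} - X_t`. -/
theorem tendsto_covariance (hα : -(1 / 2) < α) (hγ : -1 < γ) (hαβγ : -(3 / 2) < α + β + γ) :
    Tendsto (fun t => (∫ s in Ioi 0, kernel α β γ 1 s *
      (kernel α β γ (t + 1) s - kernel α β γ t s)) / t ^ (β + γ)) atTop
      (𝓝 (∫ s in Ioo 0 1, kernel α β γ 1 s * s ^ α)) := by
  set A := ∫ s in Ioo 0 1, kernel α β γ 1 s * s ^ α with hA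
  have key := tendsto_div_of_mem_Icc (f := fun t => ∫ s in Ioi 0, kernel α β γ 1 s *
    (kernel α β γ (t + 1) s - kernel α β γ t s)) (a := fun t => t ^ (β + γ)) (B := fun _ => A)
    (ψ := fun _ => 1) (L := A) (|β| + |γ|)
    ((eventually_gt_atTop 0).mono fun t ht => Real.rpow_pos_of_pos ht _)
    (Eventually.of_forall fun _ => one_pos) (by simp) ?_
  · simpa using key
  intro t ht
  have ht0 : 0 < t := by linarith
  set r := t / (t - 1) with hr
  have hr1 : 1 ≤ r := one_le_div_sub_one ht
  have hr0 : 0 < r := by linarith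
  rw [setIntegral_kernel_mul]
  have hint : IntegrableOn (fun s => kernel α β γ 1 s *
      (kernel α β γ (t + 1) s - kernel α β γ t s)) (Ioo 0 1) :=
    IntegrableOn.mono_set (t := Ioi 0) ((memLp_kernel hα hγ hαβγ 1).integrable_mul
      ((memLp_kernel hα hγ hαβγ (t + 1)).sub (memLp_kernel hα hγ hαβγ t))) fun s hs => hs.1
  have hK := integrableOn_kernel_mul_rpow hα hγ hαβγ 1
  -- For 0 < s < 1 both u and u - s lie in [t - 1, t + 1], so the bound is uniform in s and the
  -- interval has length one.
  have hJ : ∀ s ∈ Ioo (0 : ℝ) 1, ∫ u in t..t + 1, u ^ β * (u - s) ^ γ ∈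
      Icc (t ^ (β + γ) * r ^ (-(|β| + |γ|))) (t ^ (β + γ) * r ^ (|β| + |γ|)) := by
    intro s hs
    have hb : ∀ u ∈ Icc t (t + 1), u ^ β * (u - s) ^ γ ∈
        Icc (t ^ (β + γ) * r ^ (-(|β| + |γ|))) (t ^ (β + γ) * r ^ (|β| + |γ|)) := by
      intro u hu
      have h1 := rpow_mem_Icc_of_mem β ht (x := u) ⟨by linarith [hu.1], hu.2⟩
      have h2 := rpow_mem_Icc_of_mem γ ht (x := u - s)
        ⟨by linarith [hu.1, hs.2], by linarith [hu.2, hs.1]⟩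
      rw [neg_add, Real.rpow_add ht0, Real.rpow_add hr0, Real.rpow_add hr0]
      have hu0 : 0 ≤ u ^ β := Real.rpow_nonneg (by linarith [hu.1]) _
      have hu1 : 0 ≤ (u - s) ^ γ := Real.rpow_nonneg (by linarith [hu.1, hs.2]) _
      constructor
      · refine Eq.trans_le ?_ (mul_le_mul h1.1 h2.1 (by positivity) hu0)
        ring
      · refine (mul_le_mul h1.2 h2.2 hu1 (by positivity)).trans_eq ?_
        ring
    have hi := intervalIntegrable_rpow_mul_sub_rpow (β := β) hγ s ht0 (by linarith : t ≤ t + 1)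
    constructor
    · have := intervalIntegral.integral_mono_on (by linarith) intervalIntegrable_const hi
        fun u hu => (hb u hu).1
      simpa using this
    · have := intervalIntegral.integral_mono_on (by linarith) hi intervalIntegrable_const
        fun u hu => (hb u hu).2
      simpa using this
  have hdiff : ∀ s ∈ Ioo (0 : ℝ) 1, kernel α β γ (t + 1) s - kernel α β γ t s =
      s ^ α * ∫ u in t..t + 1, u ^ β * (u - s) ^ γ := by
    intro s hs
    rw [kernel_sub_kernel hγ hs.1 (by linarith [hs.2]), max_eq_right (by linarith [hs.2])]
  constructor
  · rw [hA, ← integral_const_mul]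
    refine setIntegral_mono_on (hK.const_mul _) hint measurableSet_Ioo fun s hs => ?_
    rw [hdiff s hs, mul_comm (t ^ (β + γ) * _), ← mul_assoc (kernel α β γ 1 s)]
    exact mul_le_mul_of_nonneg_left (hJ s hs).1
      (mul_nonneg (kernel_nonneg hγ s 1) (Real.rpow_nonneg hs.1.le _))
  · rw [hA, ← integral_const_mul]
    refine setIntegral_mono_on hint (hK.const_mul _) measurableSet_Ioo fun s hs => ?_
    rw [hdiff s hs, mul_comm (t ^ (β + γ) * _), ← mul_assoc (kernel α β γ 1 s)]
    exact mul_le_mul_of_nonneg_left (hJ s hs).2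
      (mul_nonneg (kernel_nonneg hγ s 1) (Real.rpow_nonneg hs.1.le _))

/-- The function `v ↦ ∫_{max v 0}^{v+1} x^γ dx`. -/
noncomputable def incr (γ v : ℝ) : ℝ := ((v + 1) ^ (γ + 1) - max v 0 ^ (γ + 1)) / (γ + 1)

theorem continuous_incr (hγ : -1 < γ) : Continuous (incr γ) := by
  unfold incr
  refine Continuous.div_const (Continuous.sub ?_ ?_) _
  · exact (continuous_id.add continuous_const).rpow_const fun _ => Or.inr (by linarith)
  · exact (continuous_id.max continuous_const).rpow_const fun _ => Or.inr (by linarith)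

theorem incr_nonneg (hγ : -1 < γ) {v : ℝ} (hv : -1 ≤ v) : 0 ≤ incr γ v := by
  refine div_nonneg (sub_nonneg.2 (Real.rpow_le_rpow (le_max_right _ _) ?_ (by linarith)))
    (by linarith)
  exact max_le (by linarith) (by linarith)

/-- The variance of `X_{t+1} - X_t` for `β = 0`. -/
noncomputable def incrVar (α γ t : ℝ) : ℝ :=
  ∫ v in (-1 : ℝ)..t, (t - v) ^ (2 * α) * incr γ v ^ 2

theorem intervalIntegrable_incrVar (hα : -(1 / 2) < α) (hγ : -1 < γ) (t a b : ℝ) :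
    IntervalIntegrable (fun v => (t - v) ^ (2 * α) * incr γ v ^ 2) volume a b := by
  refine IntervalIntegrable.mul_continuousOn ?_ ((continuous_incr hγ).pow 2).continuousOn
  simpa using (intervalIntegral.intervalIntegrable_rpow' (r := 2 * α) (by linarith) (a := t - a)
    (b := t - b)).comp_sub_left t

/-- The increment only involves u ∈ [t, t + 1], where u^β is t^β up to the factor r^|β|. Hence β
enters the variance only through t^(2β), and the case β = 0 suffices. -/
theorem variance_mem_Icc (hα : -(1 / 2) < α) (hγ : -1 < γ) (hαβγ : -(3 / 2) < α + β + γ) {t : ℝ}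
    (ht : 2 ≤ t) :
    ∫ s in Ioi 0, (kernel α β γ (t + 1) s - kernel α β γ t s) ^ 2 ∈
      Icc (t ^ (2 * β) * (t / (t - 1)) ^ (-(2 * |β|)) * incrVar α γ t)
        (t ^ (2 * β) * (t / (t - 1)) ^ (2 * |β|) * incrVar α γ t) := by
  have ht0 : 0 < t := by linarith
  set r := t / (t - 1) with hr
  have hr1 : 1 ≤ r := one_le_div_sub_one ht
  have hr0 : 0 < r := by linarith
  -- Substitution v = t - s; the values v < 0 correspond to noise in (t, t + 1).
  have hI : incrVar α γ t = ∫ s in Ioo 0 (t + 1), s ^ (2 * α) * incr γ (t - s) ^ 2 := by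
    have := intervalIntegral.integral_comp_sub_left (a := 0) (b := t + 1)
      (fun v => (t - v) ^ (2 * α) * incr γ v ^ 2) t
    simp only [sub_sub_cancel, sub_zero, sub_add_cancel_left] at this
    rw [incrVar, ← this, intervalIntegral.integral_of_le (by linarith),
      integral_Ioc_eq_integral_Ioo]
  have hIi : IntegrableOn (fun s => s ^ (2 * α) * incr γ (t - s) ^ 2) (Ioo 0 (t + 1)) := by
    have := (intervalIntegrable_incrVar hα hγ t (t - 0) (t - (t + 1))).comp_sub_left t
    simp only [sub_sub_cancel] at this
    exact (intervalIntegrable_iff_integrableOn_Ioo_of_le (by linarith)).1 this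
  have hV : ∫ s in Ioi 0, (kernel α β γ (t + 1) s - kernel α β γ t s) ^ 2 =
      ∫ s in Ioo 0 (t + 1), (kernel α β γ (t + 1) s - kernel α β γ t s) ^ 2 := by
    refine setIntegral_eq_of_subset_of_forall_sdiff_eq_zero measurableSet_Ioi
      (fun s hs => hs.1) fun s hs => ?_
    have hs1 : t + 1 ≤ s := not_lt.1 fun h => hs.2 ⟨hs.1, h⟩
    rw [kernel_of_le hs1, kernel_of_le (by linarith), sub_self, zero_pow two_ne_zero]
  have hVi : IntegrableOn (fun s => (kernel α β γ (t + 1) s - kernel α β γ t s) ^ 2)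
      (Ioo 0 (t + 1)) :=
    IntegrableOn.mono_set (t := Ioi 0) ((memLp_kernel hα hγ hαβγ (t + 1)).sub
      (memLp_kernel hα hγ hαβγ t)).integrable_sq fun s hs => hs.1
  have hD : ∀ s ∈ Ioo 0 (t + 1), ∫ u in max s t..t + 1, u ^ β * (u - s) ^ γ ∈
      Icc (t ^ β * r ^ (-|β|) * incr γ (t - s)) (t ^ β * r ^ |β| * incr γ (t - s)) := by
    intro s hs
    have hm : max s t ≤ t + 1 := max_le hs.2.le (by linarith)
    have hi := intervalIntegrable_rpow_mul_sub_rpow (β := β) hγ s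
      (ht0.trans_le (le_max_right s t)) hm
    have hi' := intervalIntegrable_sub_rpow hγ s (max s t) (t + 1)
    have e : incr γ (t - s) = ∫ u in max s t..t + 1, (u - s) ^ γ := by
      rw [integral_sub_rpow hγ, incr, ← max_sub_sub_right, sub_self, max_comm (t - s),
        show t - s + 1 = t + 1 - s by ring]
    rw [e, ← intervalIntegral.integral_const_mul, ← intervalIntegral.integral_const_mul]
    have hu0 : ∀ u ∈ Icc (max s t) (t + 1), 0 ≤ (u - s) ^ γ := fun u hu =>
      Real.rpow_nonneg (sub_nonneg.2 ((le_max_left s t).trans hu.1)) _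
    have hub : ∀ u ∈ Icc (max s t) (t + 1), u ^ β ∈ Icc (t ^ β * r ^ (-|β|)) (t ^ β * r ^ |β|) :=
      fun u hu => rpow_mem_Icc_of_mem β ht ⟨by linarith [(le_max_right s t).trans hu.1], hu.2⟩
    exact ⟨intervalIntegral.integral_mono_on hm (hi'.const_mul _) hi fun u hu =>
        mul_le_mul_of_nonneg_right (hub u hu).1 (hu0 u hu),
      intervalIntegral.integral_mono_on hm hi (hi'.const_mul _) fun u hu =>
        mul_le_mul_of_nonneg_right (hub u hu).2 (hu0 u hu)⟩
  have hsq : ∀ e s : ℝ, 0 < s → t ^ (2 * β) * r ^ (2 * e) *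
      (s ^ (2 * α) * incr γ (t - s) ^ 2) = (s ^ α * (t ^ β * r ^ e * incr γ (t - s))) ^ 2 := by
    intro e s hs
    simp only [two_mul, Real.rpow_add hs, Real.rpow_add ht0, Real.rpow_add hr0]
    ring
  have hinc : ∀ s ∈ Ioo 0 (t + 1), 0 ≤ incr γ (t - s) := fun s hs =>
    incr_nonneg hγ (by linarith [hs.2])
  rw [hV, hI, ← integral_const_mul, ← integral_const_mul, ← mul_neg]
  constructor
  · refine setIntegral_mono_on (hIi.const_mul _) hVi measurableSet_Ioo fun s hs => ?_
    rw [hsq _ _ hs.1, kernel_sub_kernel hγ hs.1 hs.2]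
    have h0 := hinc s hs
    have h1 := hs.1
    exact pow_le_pow_left₀ (by positivity) (mul_le_mul_of_nonneg_left (hD s hs).1
      (Real.rpow_nonneg hs.1.le _)) 2
  · refine setIntegral_mono_on hVi (hIi.const_mul _) measurableSet_Ioo fun s hs => ?_
    rw [hsq _ _ hs.1, kernel_sub_kernel hγ hs.1 hs.2]
    have h0 := hinc s hs
    have h1 := hs.1
    have h2 := (hD s hs).1
    refine pow_le_pow_left₀ (mul_nonneg (by positivity) (le_trans (by positivity) h2))
      (mul_le_mul_of_nonneg_left (hD s hs).2 (Real.rpow_nonneg hs.1.le _)) 2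

end Sandwich

/-! ### Asymptotics of the variance in the three regimes of γ -/

section IncrVar

variable {α γ : ℝ}

theorem incr_pos (hγ : -1 < γ) {v : ℝ} (hv : -1 < v) : 0 < incr γ v :=
  div_pos (sub_pos.2 (Real.rpow_lt_rpow (le_max_right _ _)
    (max_lt (by linarith) (by linarith)) (by linarith))) (by linarith)

/-- For v > 0 this is the mean of x^γ over [v, v + 1], hence lies between the endpoint values,
whatever the sign of γ. -/
theorem incr_mem_Icc (hγ : -1 < γ) {v : ℝ} (hv : 0 < v) :
    incr γ v ∈ Icc (min (v ^ γ) ((v + 1) ^ γ)) (max (v ^ γ) ((v + 1) ^ γ)) := by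
  have e : incr γ v = ∫ x in v..v + 1, x ^ γ := by
    rw [integral_rpow (Or.inl hγ), incr, max_eq_left hv.le]
  have hb : ∀ x ∈ Icc v (v + 1),
      x ^ γ ∈ Icc (min (v ^ γ) ((v + 1) ^ γ)) (max (v ^ γ) ((v + 1) ^ γ)) := by
    intro x hx
    have hx0 : 0 < x := hv.trans_le hx.1
    rcases le_total 0 γ with h | h
    · exact ⟨(min_le_left _ _).trans (Real.rpow_le_rpow hv.le hx.1 h),
        (Real.rpow_le_rpow hx0.le hx.2 h).trans (le_max_right _ _)⟩
    · exact ⟨(min_le_right _ _).trans (Real.rpow_le_rpow_of_nonpos hx0 hx.2 h),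
        (Real.rpow_le_rpow_of_nonpos hv hx.1 h).trans (le_max_left _ _)⟩
  have hi : IntervalIntegrable (fun x : ℝ => x ^ γ) volume v (v + 1) :=
    intervalIntegral.intervalIntegrable_rpow' hγ
  rw [e]
  constructor
  · simpa using intervalIntegral.integral_mono_on (by linarith) intervalIntegrable_const hi
      fun x hx => (hb x hx).1
  · simpa using intervalIntegral.integral_mono_on (by linarith) hi intervalIntegrable_const
      fun x hx => (hb x hx).2

theorem incr_le_rpow (hγ : -1 < γ) (hγ0 : γ ≤ 0) {v : ℝ} (hv : 0 < v) : incr γ v ≤ v ^ γ :=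
  (incr_mem_Icc hγ hv).2.trans
    (max_le le_rfl (Real.rpow_le_rpow_of_nonpos hv (by linarith) hγ0))

theorem rpow_le_incr (hγ : -1 < γ) (hγ0 : γ ≤ 0) {v : ℝ} (hv : 0 < v) :
    (v + 1) ^ γ ≤ incr γ v :=
  (le_min (Real.rpow_le_rpow_of_nonpos hv (by linarith) hγ0) le_rfl).trans
    (incr_mem_Icc hγ hv).1

theorem rpow_sq {x : ℝ} (hx : 0 ≤ x) (e : ℝ) : (x ^ e) ^ 2 = x ^ (2 * e) := by
  rw [mul_comm, Real.rpow_mul hx, Real.rpow_ofNat]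

theorem incr_sq_le (hγ : -1 < γ) (hγ0 : γ ≤ 0) {v : ℝ} (hv : 0 < v) :
    incr γ v ^ 2 ≤ v ^ (2 * γ) := by
  rw [← rpow_sq hv.le]
  exact pow_le_pow_left₀ (incr_nonneg hγ (by linarith)) (incr_le_rpow hγ hγ0 hv) 2

theorem head_nonneg {t c : ℝ} (hc : -1 ≤ c) (hct : c ≤ t) :
    0 ≤ ∫ v in (-1 : ℝ)..c, (t - v) ^ (2 * α) * incr γ v ^ 2 :=
  intervalIntegral.integral_nonneg hc fun v hv =>
    mul_nonneg (Real.rpow_nonneg (by linarith [hv.2]) _) (sq_nonneg _)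

theorem head_le (hα : -(1 / 2) < α) (hγ : -1 < γ) {t c : ℝ} (hc : -1 ≤ c) (hc1 : c ≤ 1)
    (ht : 2 ≤ t) : ∫ v in (-1 : ℝ)..c, (t - v) ^ (2 * α) * incr γ v ^ 2 ≤
      t ^ (2 * α) * (2 ^ |2 * α| * ∫ v in (-1 : ℝ)..c, incr γ v ^ 2) := by
  rw [← mul_assoc, ← intervalIntegral.integral_const_mul]
  refine intervalIntegral.integral_mono_on hc (intervalIntegrable_incrVar hα hγ t _ _)
    ((((continuous_incr hγ).pow 2).intervalIntegrable _ _).const_mul _) fun v hv => ?_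
  exact mul_le_mul_of_nonneg_right (rpow_mem_Icc (2 * α) (by linarith) one_le_two
    (by linarith [hv.2]) (by linarith [hv.1])).2 (sq_nonneg _)

/-- The part of the integral that is near `v = -1` is negligible if `ψ` tends to infinity. -/
theorem tendsto_head (hα : -(1 / 2) < α) (hγ : -1 < γ) {c : ℝ} (hc : -1 ≤ c) (hc1 : c ≤ 1)
    {ψ : ℝ → ℝ} (hψ : Tendsto ψ atTop atTop) :
    Tendsto (fun t => (∫ v in (-1 : ℝ)..c, (t - v) ^ (2 * α) * incr γ v ^ 2) /
      (t ^ (2 * α) * ψ t)) atTop (𝓝 0) := by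
  set C := 2 ^ |2 * α| * ∫ v in (-1 : ℝ)..c, incr γ v ^ 2 with hC
  refine tendsto_of_tendsto_of_tendsto_of_le_of_le' tendsto_const_nhds
    (tendsto_const_nhds.div_atTop hψ (a := C)) ?_ ?_
  · filter_upwards [eventually_ge_atTop 2, hψ.eventually_gt_atTop 0] with t ht h0
    have h1 := head_nonneg (α := α) (γ := γ) hc (t := t) (by linarith)
    positivity
  · filter_upwards [eventually_ge_atTop 2, hψ.eventually_gt_atTop 0] with t ht h0
    have h1 := head_le hα hγ hc hc1 ht
    have h2 : 0 < t ^ (2 * α) := Real.rpow_pos_of_pos (by linarith) _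
    rw [div_le_iff₀ (mul_pos h2 h0)]
    refine h1.trans_eq ?_
    rw [← hC]
    field_simp

/-- Near v = t the factor (t - v)^(2α) may be singular, so it is integrated exactly, while `incr`²
is bounded by (t / 2)^(2γ). -/
theorem tail_le (hα : -(1 / 2) < α) (hγ : -1 < γ) (hγ0 : γ ≤ 0) {t : ℝ} (ht : 0 < t) :
    ∫ v in (t / 2)..t, (t - v) ^ (2 * α) * incr γ v ^ 2 ≤
      (t / 2) ^ (2 * γ) * ((t / 2) ^ (2 * α + 1) / (2 * α + 1)) := by
  have hα' : -1 < 2 * α := by linarith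
  have e : ∫ v in (t / 2)..t, (t - v) ^ (2 * α) = (t / 2) ^ (2 * α + 1) / (2 * α + 1) := by
    rw [intervalIntegral.integral_comp_sub_left (fun v => v ^ (2 * α)) t, sub_self,
      integral_rpow (Or.inl hα'), Real.zero_rpow (by linarith), sub_zero, sub_half]
  rw [← e, ← intervalIntegral.integral_const_mul]
  refine intervalIntegral.integral_mono_on (by linarith) (intervalIntegrable_incrVar hα hγ t _ _)
    (IntervalIntegrable.const_mul ?_ _) fun v hv => ?_
  · simpa using (intervalIntegral.intervalIntegrable_rpow' hα' (a := t - t / 2)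
      (b := t - t)).comp_sub_left t
  · have hv0 : 0 < v := by linarith [hv.1]
    rw [mul_comm]
    refine mul_le_mul_of_nonneg_right ((incr_sq_le hγ hγ0 hv0).trans ?_)
      (Real.rpow_nonneg (by linarith [hv.2]) _)
    exact Real.rpow_le_rpow_of_nonpos (by linarith) hv.1 (by linarith)

theorem integrableOn_incr_sq (hγ : -1 < γ) (hγ1 : γ < -(1 / 2)) :
    IntegrableOn (fun v => incr γ v ^ 2) (Ioi (-1)) := by
  rw [← Ioc_union_Ioi_eq_Ioi (show (-1 : ℝ) ≤ 1 by norm_num)]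
  refine IntegrableOn.union (((continuous_incr hγ).pow 2).integrableOn_Ioc) ?_
  refine Integrable.mono' (integrableOn_Ioi_rpow_of_lt (a := 2 * γ) (by linarith) one_pos)
    ((continuous_incr hγ).pow 2).aestronglyMeasurable ?_
  refine (ae_restrict_mem measurableSet_Ioi).mono fun v hv => ?_
  rw [Real.norm_of_nonneg (sq_nonneg _)]
  exact incr_sq_le hγ (by linarith) (one_pos.trans hv)

theorem integral_incr_sq_pos (hγ : -1 < γ) (hγ1 : γ < -(1 / 2)) :
    0 < ∫ v in Ioi (-1), incr γ v ^ 2 := by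
  have h : 0 < ∫ v in (-1 : ℝ)..0, incr γ v ^ 2 :=
    intervalIntegral.intervalIntegral_pos_of_pos_on
      (((continuous_incr hγ).pow 2).intervalIntegrable _ _)
      (fun v hv => pow_pos (incr_pos hγ hv.1) 2) (by norm_num)
  rw [intervalIntegral.integral_of_le (by norm_num)] at h
  exact h.trans_le (setIntegral_mono_set (integrableOn_incr_sq hγ hγ1)
    (ae_of_all _ fun v => sq_nonneg _) (Ioc_subset_Ioi_self : Ioc (-1 : ℝ) 0 ⊆ _).eventuallyLE)

theorem sub_rpow_eq {t v : ℝ} (e : ℝ) (ht : 0 < t) (hv : v ≤ t) :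
    (t - v) ^ e = t ^ e * (1 - v / t) ^ e := by
  rw [← Real.mul_rpow ht.le (sub_nonneg.2 ((div_le_one ht).2 hv)), mul_sub, mul_one,
    mul_div_cancel₀ _ ht.ne']

/-- The asymptotics of the variance for `γ < -1/2`. -/
theorem tendsto_incrVar_of_lt (hα : -(1 / 2) < α) (hγ : -1 < γ) (hγ1 : γ < -(1 / 2)) :
    Tendsto (fun t => incrVar α γ t / t ^ (2 * α)) atTop (𝓝 (∫ v in Ioi (-1), incr γ v ^ 2)) := by
  -- Cutting at t / 2 keeps 1 - v / t in [1/2, 2], which gives a dominating function even for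
  -- negative α.
  have h1 : Tendsto (fun t : ℝ => ∫ v in Ioi (-1),
      (Iic (t / 2)).indicator (fun v => (1 - v / t) ^ (2 * α) * incr γ v ^ 2) v) atTop
      (𝓝 (∫ v in Ioi (-1), incr γ v ^ 2)) := by
    refine tendsto_integral_filter_of_dominated_convergence
      (fun v => 2 ^ |2 * α| * incr γ v ^ 2) ?_ ?_ ((integrableOn_incr_sq hγ hγ1).const_mul _) ?_
    · refine Eventually.of_forall fun t => ?_
      have : Measurable fun v => (1 - v / t) ^ (2 * α) * incr γ v ^ 2 :=
        ((measurable_const.sub (measurable_id.div_const t)).pow_const _).mul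
          ((continuous_incr hγ).measurable.pow_const 2)
      exact (this.indicator measurableSet_Iic).aestronglyMeasurable
    · filter_upwards [eventually_ge_atTop 2] with t ht
      refine (ae_restrict_mem measurableSet_Ioi).mono fun v hv => ?_
      have ht0 : 0 < t := by linarith
      rw [mem_Ioi] at hv
      by_cases hvt : v ∈ Iic (t / 2)
      · rw [indicator_of_mem hvt, norm_mul, Real.norm_of_nonneg (sq_nonneg _)]
        refine mul_le_mul_of_nonneg_right ?_ (sq_nonneg _)
        have h3 : v / t ≤ 1 / 2 := by rw [div_le_iff₀ ht0]; linarith [mem_Iic.1 hvt]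
        have h4 : -1 ≤ v / t := by rw [le_div_iff₀ ht0]; linarith
        rw [Real.norm_of_nonneg (Real.rpow_nonneg (by linarith) _)]
        simpa using (rpow_mem_Icc (t := 1) (r := 2) (x := 1 - v / t) (2 * α) one_pos one_le_two
          (by linarith) (by linarith)).2
      · rw [indicator_of_notMem hvt, norm_zero]
        positivity
    · refine ae_of_all _ fun v => ?_
      have h2 : Tendsto (fun t : ℝ => (1 - v / t) ^ (2 * α) * incr γ v ^ 2) atTop
          (𝓝 ((1 - 0) ^ (2 * α) * incr γ v ^ 2)) :=
        ((((tendsto_const_nhds (x := v)).div_atTop tendsto_id).const_sub 1).rpow_const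
          (Or.inl (by norm_num))).mul_const _
      rw [sub_zero, Real.one_rpow, one_mul] at h2
      refine h2.congr' ?_
      filter_upwards [eventually_ge_atTop (2 * v)] with t ht
      rw [indicator_of_mem (show v ∈ Iic (t / 2) by rw [mem_Iic]; linarith)]
  -- The normalized tail is O(t^(2γ+1)), and 2γ + 1 < 0.
  have h2 : Tendsto (fun t : ℝ => (∫ v in (t / 2)..t, (t - v) ^ (2 * α) * incr γ v ^ 2) /
      t ^ (2 * α)) atTop (𝓝 0) := by
    have h3 : Tendsto (fun t : ℝ => (2 : ℝ)⁻¹ ^ (2 * γ) * (2⁻¹ ^ (2 * α + 1) / (2 * α + 1)) *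
        t ^ (-(-(2 * γ + 1)))) atTop (𝓝 0) := by
      simpa using (tendsto_rpow_neg_atTop (y := -(2 * γ + 1)) (by linarith)).const_mul
        ((2 : ℝ)⁻¹ ^ (2 * γ) * (2⁻¹ ^ (2 * α + 1) / (2 * α + 1)))
    refine tendsto_of_tendsto_of_tendsto_of_le_of_le' tendsto_const_nhds h3 ?_ ?_
    · filter_upwards [eventually_gt_atTop 0] with t ht
      refine div_nonneg (intervalIntegral.integral_nonneg (by linarith) fun v hv => ?_)
        (Real.rpow_nonneg ht.le _)
      exact mul_nonneg (Real.rpow_nonneg (by linarith [hv.2]) _) (sq_nonneg _)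
    · filter_upwards [eventually_gt_atTop 0] with t ht
      rw [div_le_iff₀ (Real.rpow_pos_of_pos ht _)]
      refine (tail_le hα hγ (by linarith) ht).trans_eq ?_
      rw [div_eq_mul_inv t, Real.mul_rpow ht.le (by norm_num), Real.mul_rpow ht.le (by norm_num),
        neg_neg, Real.rpow_add_one ht.ne', Real.rpow_add_one ht.ne']
      ring
  have h3 := h1.add h2
  rw [add_zero] at h3
  refine h3.congr' ?_
  filter_upwards [eventually_ge_atTop 2] with t ht
  have ht0 : 0 < t := by linarith
  rw [incrVar, ← intervalIntegral.integral_add_adjacent_intervals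
    (intervalIntegrable_incrVar hα hγ t (-1) (t / 2))
    (intervalIntegrable_incrVar hα hγ t (t / 2) t),
    add_div, setIntegral_indicator measurableSet_Iic, Ioi_inter_Iic]
  congr 1
  rw [intervalIntegral.integral_of_le (by linarith), ← integral_div]
  refine setIntegral_congr_fun measurableSet_Ioc fun v hv => ?_
  have := Real.rpow_pos_of_pos ht0 (2 * α)
  rw [sub_rpow_eq _ ht0 (by linarith [hv.2])]
  field_simp

/-- On each side of 1/2 only one factor can be singular; the other is bounded by 2^|b| or 2^|e|. -/
theorem integrableOn_one_sub_rpow_mul_rpow {b e : ℝ} (hb : -1 < b) (he : -1 < e) :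
    IntegrableOn (fun x : ℝ => (1 - x) ^ b * x ^ e) (Ioo 0 1) := by
  have h1 : IntegrableOn (fun x : ℝ => (1 - x) ^ b) (Ioo 0 1) :=
    (intervalIntegrable_iff_integrableOn_Ioo_of_le zero_le_one).1 (by
      simpa using (intervalIntegral.intervalIntegrable_rpow' hb (a := 1 - 0)
        (b := 1 - 1)).comp_sub_left 1)
  have hm : Measurable fun x : ℝ => (1 - x) ^ b * x ^ e :=
    ((measurable_const.sub measurable_id).pow_const _).mul (measurable_id.pow_const _)
  refine Integrable.mono' (((integrableOn_Ioo_rpow he 1).const_mul (2 ^ |b|)).add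
    (h1.const_mul (2 ^ |e|))) hm.aestronglyMeasurable ?_
  refine (ae_restrict_mem measurableSet_Ioo).mono fun x hx => ?_
  have hx0 : 0 < x := hx.1
  have hx1 : 0 < 1 - x := sub_pos.2 hx.2
  rw [Real.norm_of_nonneg (by positivity)]
  simp only [Pi.add_apply]
  rcases le_total x (1 / 2) with h | h
  · have h2 : (1 - x) ^ b ≤ 2 ^ |b| := by
      simpa using (rpow_mem_Icc (t := 1) (r := 2) (x := 1 - x) b one_pos one_le_two
        (by linarith) (by linarith)).2
    exact (mul_le_mul_of_nonneg_right h2 (by positivity)).trans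
      (le_add_of_nonneg_right (by positivity))
  · have h2 : x ^ e ≤ 2 ^ |e| := by
      simpa using (rpow_mem_Icc (t := 1) (r := 2) (x := x) e one_pos one_le_two
        (by linarith) (by linarith)).2
    rw [mul_comm]
    exact (mul_le_mul_of_nonneg_right h2 (by positivity)).trans
      (le_add_of_nonneg_left (by positivity))

theorem integral_one_sub_rpow_mul_rpow_pos {b e : ℝ} (hb : -1 < b) (he : -1 < e) :
    0 < ∫ x in Ioo (0 : ℝ) 1, (1 - x) ^ b * x ^ e := by
  have h := intervalIntegral.intervalIntegral_pos_of_pos_on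
    ((intervalIntegrable_iff_integrableOn_Ioo_of_le zero_le_one).2
      (integrableOn_one_sub_rpow_mul_rpow hb he))
    (fun x hx => mul_pos (Real.rpow_pos_of_pos (sub_pos.2 hx.2) _)
      (Real.rpow_pos_of_pos hx.1 _)) one_pos
  rwa [intervalIntegral.integral_of_le zero_le_one, integral_Ioc_eq_integral_Ioo] at h

/-- Bounds for the scaled function `incr`, both of which tend to `x ^ γ` as `t → ∞`. -/
theorem rpow_neg_mul_incr_mem_Icc (hγ : -1 < γ) {t x : ℝ} (ht : 0 < t) (hx : 0 < x) :
    t ^ (-γ) * incr γ (t * x) ∈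
      Icc (min (x ^ γ) ((x + t⁻¹) ^ γ)) (max (x ^ γ) ((x + t⁻¹) ^ γ)) := by
  have h := incr_mem_Icc hγ (mul_pos ht hx)
  have e : t * x + 1 = t * (x + t⁻¹) := by field_simp
  have ht' : 0 < t ^ γ := Real.rpow_pos_of_pos ht _
  rw [e, Real.mul_rpow ht.le hx.le, Real.mul_rpow ht.le (by positivity),
    ← mul_min_of_nonneg _ _ ht'.le, ← mul_max_of_nonneg _ _ ht'.le] at h
  rw [Real.rpow_neg ht.le, inv_mul_eq_div]
  exact ⟨(le_div_iff₀' ht').2 h.1, (div_le_iff₀' ht').2 h.2⟩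

/-- The asymptotics of the variance for `γ > -1/2`. -/
theorem tendsto_incrVar_of_gt (hα : -(1 / 2) < α) (hγ1 : -(1 / 2) < γ) :
    Tendsto (fun t => incrVar α γ t / (t ^ (2 * α) * t ^ (2 * γ + 1))) atTop
      (𝓝 (∫ x in Ioo (0 : ℝ) 1, (1 - x) ^ (2 * α) * x ^ (2 * γ))) := by
  have hγ : -1 < γ := by linarith
  have h1 : Tendsto (fun t : ℝ => ∫ x in Ioo (0 : ℝ) 1,
      (1 - x) ^ (2 * α) * (t ^ (-γ) * incr γ (t * x)) ^ 2) atTop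
      (𝓝 (∫ x in Ioo (0 : ℝ) 1, (1 - x) ^ (2 * α) * x ^ (2 * γ))) := by
    -- For t ≥ 1 the scaled `incr` is at most x^γ + 2^γ: the first term serves γ ≤ 0, the second γ ≥
    -- 0. Squaring with (a + b)² ≤ 2a² + 2b² gives this dominating function.
    refine tendsto_integral_filter_of_dominated_convergence
      (fun x => 2 * ((1 - x) ^ (2 * α) * x ^ (2 * γ)) +
        2 * (2 ^ γ) ^ 2 * ((1 - x) ^ (2 * α) * x ^ (0 : ℝ))) ?_ ?_ ?_ ?_
    · refine Eventually.of_forall fun t => Measurable.aestronglyMeasurable ?_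
      exact ((measurable_const.sub measurable_id).pow_const _).mul
        ((measurable_const.mul ((continuous_incr hγ).measurable.comp
          (measurable_const.mul measurable_id))).pow_const 2)
    · filter_upwards [eventually_ge_atTop 1] with t ht
      refine (ae_restrict_mem measurableSet_Ioo).mono fun x hx => ?_
      have ht0 : 0 < t := by linarith
      have hx0 : 0 < x := hx.1
      have hx1 : 0 < 1 - x := sub_pos.2 hx.2
      have ht1 : t⁻¹ ≤ 1 := inv_le_one_of_one_le₀ ht
      have hti : 0 < t⁻¹ := inv_pos.2 ht0
      have h2 : t ^ (-γ) * incr γ (t * x) ≤ x ^ γ + 2 ^ γ := by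
        refine (rpow_neg_mul_incr_mem_Icc hγ ht0 hx0).2.trans (max_le ?_ ?_)
        · exact le_add_of_nonneg_right (by positivity)
        · rcases le_total 0 γ with h | h
          · exact (Real.rpow_le_rpow (by positivity) (by linarith) h).trans
              (le_add_of_nonneg_left (by positivity))
          · exact (Real.rpow_le_rpow_of_nonpos hx0 (by linarith) h).trans
              (le_add_of_nonneg_right (by positivity))
      have h3 : 0 ≤ t ^ (-γ) * incr γ (t * x) :=
        mul_nonneg (by positivity) (incr_nonneg hγ (by nlinarith))
      rw [Real.norm_of_nonneg (by positivity), Real.rpow_zero, mul_one, ← rpow_sq hx0.le]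
      calc (1 - x) ^ (2 * α) * (t ^ (-γ) * incr γ (t * x)) ^ 2
          ≤ (1 - x) ^ (2 * α) * (2 * (x ^ γ) ^ 2 + 2 * (2 ^ γ) ^ 2) := by
            refine mul_le_mul_of_nonneg_left ((pow_le_pow_left₀ h3 h2 2).trans ?_) (by positivity)
            nlinarith [sq_nonneg (x ^ γ - 2 ^ γ)]
        _ = _ := by ring
    · exact ((integrableOn_one_sub_rpow_mul_rpow (by linarith) (by linarith)).const_mul _).add
        ((integrableOn_one_sub_rpow_mul_rpow (by linarith) (by norm_num)).const_mul _)
    · refine (ae_restrict_mem measurableSet_Ioo).mono fun x hx => ?_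
      have h2 : Tendsto (fun t : ℝ => (x + t⁻¹) ^ γ) atTop (𝓝 (x ^ γ)) := by
        simpa using (tendsto_inv_atTop_zero.const_add x).rpow_const (p := γ)
          (Or.inl (by simpa using hx.1.ne'))
      have h3 : Tendsto (fun t : ℝ => t ^ (-γ) * incr γ (t * x)) atTop (𝓝 (x ^ γ)) := by
        have h4 := (tendsto_const_nhds (x := x ^ γ)).min h2
        have h5 := (tendsto_const_nhds (x := x ^ γ)).max h2
        rw [min_self] at h4
        rw [max_self] at h5
        refine tendsto_of_tendsto_of_tendsto_of_le_of_le' h4 h5 ?_ ?_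
        · filter_upwards [eventually_gt_atTop 0] with t ht
          exact (rpow_neg_mul_incr_mem_Icc hγ ht hx.1).1
        · filter_upwards [eventually_gt_atTop 0] with t ht
          exact (rpow_neg_mul_incr_mem_Icc hγ ht hx.1).2
      rw [← rpow_sq hx.1.le]
      exact (h3.pow 2).const_mul _
  have h2 := tendsto_head (c := 0) hα hγ (by norm_num) (by norm_num)
    (tendsto_rpow_atTop (y := 2 * γ + 1) (by linarith))
  have h3 := h2.add h1
  rw [zero_add] at h3
  refine h3.congr' ?_
  filter_upwards [eventually_gt_atTop 0] with t ht
  rw [incrVar, ← intervalIntegral.integral_add_adjacent_intervals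
    (intervalIntegrable_incrVar hα hγ t (-1) 0) (intervalIntegrable_incrVar hα hγ t 0 t),
    add_div]
  congr 1
  have hsub := intervalIntegral.smul_integral_comp_mul_left (a := 0) (b := 1)
    (fun v => (t - v) ^ (2 * α) * incr γ v ^ 2) t
  rw [mul_zero, mul_one] at hsub
  rw [← hsub, intervalIntegral.integral_of_le zero_le_one, integral_Ioc_eq_integral_Ioo,
    smul_eq_mul, ← integral_const_mul, ← integral_div]
  refine setIntegral_congr_fun measurableSet_Ioo fun x hx => ?_
  have h4 := Real.rpow_pos_of_pos ht (2 * α)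
  have h5 := Real.rpow_pos_of_pos ht γ
  rw [sub_rpow_eq (v := t * x) _ ht (by nlinarith [hx.2]), mul_div_cancel_left₀ _ ht.ne',
    Real.rpow_add_one ht.ne', ← rpow_sq ht.le γ, Real.rpow_neg ht.le]
  field_simp

/-- The asymptotics of the variance for `γ = -1/2`. -/
theorem tendsto_incrVar_of_eq (hα : -(1 / 2) < α) :
    Tendsto (fun t => incrVar α (-(1 / 2)) t / (t ^ (2 * α) * Real.log t)) atTop (𝓝 1) := by
  have hγ : (-1 : ℝ) < -(1 / 2) := by norm_num
  -- Here 1 / (q + 1) ≤ `incr`² ≤ 1 / q; multiplying by q accounts for the Jacobian of the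
  -- logarithmic substitution.
  have hq : ∀ q : ℝ, 0 < q → q * incr (-(1 / 2)) q ^ 2 ∈ Icc (q / (q + 1)) 1 := by
    intro q hq
    have e : 2 * -(1 / 2 : ℝ) = -1 := by norm_num
    constructor
    · rw [div_eq_mul_inv, ← Real.rpow_neg_one, ← e, ← rpow_sq (by linarith)]
      exact mul_le_mul_of_nonneg_left (pow_le_pow_left₀ (by positivity)
        (rpow_le_incr hγ (by norm_num) hq) 2) hq.le
    · have := incr_sq_le hγ (by norm_num) hq
      rw [e, Real.rpow_neg_one] at this
      exact (mul_le_mul_of_nonneg_left this hq.le).trans_eq (mul_inv_cancel₀ hq.ne')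
  -- With l = log t and v = e^(y l), the range 1 < v < t becomes 0 < y < 1 and the integrand tends
  -- pointwise to 1.
  have h1 : Tendsto (fun l : ℝ => ∫ y in Ioo (0 : ℝ) 1, (1 - Real.exp ((y - 1) * l)) ^ (2 * α) *
      (Real.exp (y * l) * incr (-(1 / 2)) (Real.exp (y * l)) ^ 2)) atTop
      (𝓝 (∫ y in Ioo (0 : ℝ) 1, 1)) := by
    refine tendsto_integral_filter_of_dominated_convergence
      (fun y => 1 + (2 : ℝ)⁻¹ ^ (2 * α) * ((1 - y) ^ (2 * α) * y ^ (0 : ℝ))) ?_ ?_ ?_ ?_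
    · refine Eventually.of_forall fun l => Measurable.aestronglyMeasurable ?_
      have hm : Measurable fun y : ℝ => Real.exp (y * l) := by fun_prop
      exact Measurable.mul (Measurable.pow_const (by fun_prop) _)
        (hm.mul (((continuous_incr hγ).measurable.comp hm).pow_const 2))
    · filter_upwards [eventually_ge_atTop 1] with l hl
      refine (ae_restrict_mem measurableSet_Ioo).mono fun y hy => ?_
      have hy1 : 0 < 1 - y := sub_pos.2 hy.2
      -- A lower bound uniform in l ≥ 1, needed for negative α; it rests on e^(1-y) ≥ 2 - y.
      have h2 : (1 - y) / 2 ≤ 1 - Real.exp ((y - 1) * l) := by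
        have h3 : Real.exp ((y - 1) * l) ≤ Real.exp (y - 1) :=
          Real.exp_le_exp.2 (by nlinarith)
        have h4 : Real.exp (y - 1) ≤ 1 / (2 - y) := by
          rw [← neg_sub, Real.exp_neg, inv_eq_one_div]
          refine one_div_le_one_div_of_le (by linarith [hy.2]) ?_
          linarith [Real.add_one_le_exp (1 - y)]
        have h5 : 1 / (2 - y) ≤ 1 - (1 - y) / 2 := by
          rw [div_le_iff₀ (by linarith)]
          nlinarith [hy.1]
        linarith
      have h3 : 1 - Real.exp ((y - 1) * l) ≤ 1 := by linarith [Real.exp_pos ((y - 1) * l)]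
      have h4 : 0 < 1 - Real.exp ((y - 1) * l) := lt_of_lt_of_le (by linarith) h2
      have h5 := hq _ (Real.exp_pos (y * l))
      have h6 : (1 - Real.exp ((y - 1) * l)) ^ (2 * α) ≤
          1 + (2 : ℝ)⁻¹ ^ (2 * α) * (1 - y) ^ (2 * α) := by
        rw [← Real.mul_rpow (by norm_num) hy1.le, inv_mul_eq_div]
        rcases le_total 0 (2 * α) with h | h
        · exact (Real.rpow_le_one h4.le h3 h).trans (le_add_of_nonneg_right (by positivity))
        · exact (Real.rpow_le_rpow_of_nonpos (by linarith) h2 h).trans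
            (le_add_of_nonneg_left zero_le_one)
      rw [Real.norm_of_nonneg (mul_nonneg (by positivity) (by positivity)), Real.rpow_zero, mul_one]
      exact (mul_le_of_le_one_right (by positivity) h5.2).trans h6
    · exact (integrableOn_const (by simp)).add
        ((integrableOn_one_sub_rpow_mul_rpow (by linarith) (by norm_num)).const_mul _)
    · refine (ae_restrict_mem measurableSet_Ioo).mono fun y hy => ?_
      have h2 : Tendsto (fun l : ℝ => Real.exp ((y - 1) * l)) atTop (𝓝 0) :=
        Real.tendsto_exp_atBot.comp (tendsto_id.const_mul_atTop_of_neg (by linarith [hy.2]))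
      have h3 : Tendsto (fun l : ℝ => (1 - Real.exp ((y - 1) * l)) ^ (2 * α)) atTop (𝓝 1) := by
        simpa using (h2.const_sub 1).rpow_const (p := 2 * α) (Or.inl (by norm_num))
      have h4 : Tendsto (fun l : ℝ => Real.exp (y * l)) atTop atTop :=
        Real.tendsto_exp_atTop.comp (tendsto_id.const_mul_atTop hy.1)
      have h5 : Tendsto (fun q : ℝ => q / (q + 1)) atTop (𝓝 1) := by
        have : Tendsto (fun q : ℝ => 1 - (q + 1)⁻¹) atTop (𝓝 (1 - 0)) :=
          (tendsto_inv_atTop_zero.comp (tendsto_atTop_add_const_right atTop (1 : ℝ)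
            tendsto_id)).const_sub 1
        rw [sub_zero] at this
        refine this.congr' ?_
        filter_upwards [eventually_gt_atTop 0] with q hq
        field_simp
        ring
      have h6 := tendsto_of_tendsto_of_tendsto_of_le_of_le (h5.comp h4)
        (tendsto_const_nhds (x := (1 : ℝ))) (fun l => (hq _ (Real.exp_pos (y * l))).1)
        fun l => (hq _ (Real.exp_pos (y * l))).2
      simpa using h3.mul h6
  have h2 := tendsto_head (c := 1) hα hγ (by norm_num) le_rfl Real.tendsto_log_atTop
  have h3 := h2.add (h1.comp Real.tendsto_log_atTop)
  rw [zero_add, setIntegral_const, smul_eq_mul, mul_one, Real.volume_real_Ioo_of_le zero_le_one,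
    sub_zero] at h3
  refine h3.congr' ?_
  filter_upwards [eventually_gt_atTop 1] with t ht
  have ht0 : 0 < t := by linarith
  have hl : 0 < Real.log t := Real.log_pos ht
  rw [incrVar, ← intervalIntegral.integral_add_adjacent_intervals
    (intervalIntegrable_incrVar hα hγ t (-1) 1) (intervalIntegrable_incrVar hα hγ t 1 t),
    add_div]
  congr 1
  have himg : (fun y => Real.exp (y * Real.log t)) '' Ioo 0 1 = Ioo 1 t := by
    ext v
    constructor
    · rintro ⟨y, hy, rfl⟩
      constructor
      · exact Real.one_lt_exp_iff.2 (mul_pos hy.1 hl)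
      · rw [← Real.lt_log_iff_exp_lt ht0]
        exact mul_lt_of_lt_one_left hl hy.2
    · intro hv
      have hv0 : 0 < v := one_pos.trans hv.1
      refine ⟨Real.log v / Real.log t, ⟨div_pos (Real.log_pos hv.1) hl, ?_⟩, ?_⟩
      · rw [div_lt_one hl]
        exact Real.log_lt_log hv0 hv.2
      · simp only
        rw [div_mul_cancel₀ _ hl.ne', Real.exp_log hv0]
  have hsub := integral_image_eq_integral_abs_deriv_smul (s := Ioo (0 : ℝ) 1)
    (f := fun y => Real.exp (y * Real.log t)) (f' := fun y => Real.exp (y * Real.log t) *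
      Real.log t) measurableSet_Ioo
    (fun y _ => ((hasDerivAt_mul_const (Real.log t)).exp).hasDerivWithinAt)
    (fun y _ z _ h => mul_right_cancel₀ hl.ne' (Real.exp_injective h))
    (fun v => (t - v) ^ (2 * α) * incr (-(1 / 2)) v ^ 2)
  rw [himg] at hsub
  rw [intervalIntegral.integral_of_le ht.le, integral_Ioc_eq_integral_Ioo, hsub, ← integral_div]
  refine setIntegral_congr_fun measurableSet_Ioo fun y hy => ?_
  have hle : Real.exp (y * Real.log t) ≤ t := by
    rw [← Real.le_log_iff_exp_le ht0]
    exact mul_le_of_le_one_left hl.le hy.2.le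
  have hdiv : Real.exp (y * Real.log t) / t = Real.exp ((y - 1) * Real.log t) := by
    rw [sub_mul, one_mul, Real.exp_sub, Real.exp_log ht0]
  have h4 := Real.rpow_pos_of_pos ht0 (2 * α)
  simp only [smul_eq_mul]
  rw [abs_of_pos (mul_pos (Real.exp_pos _) hl), sub_rpow_eq _ ht0 hle, hdiv]
  field_simp

end IncrVar

/-! ### From asymptotics to convergence and divergence -/

section Conclusion

theorem integrableOn_Ioc_of_abs_le_one {ρ : ℝ → ℝ}
    (hm : AEStronglyMeasurable ρ (volume.restrict (Ioi 0))) (hb : ∀ t, 0 < t → |ρ t| ≤ 1)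
    {a b : ℝ} (ha : 0 ≤ a) : IntegrableOn ρ (Ioc a b) := by
  have hsub : Ioc a b ⊆ Ioi 0 := fun t ht => ha.trans_lt ht.1
  refine Integrable.mono' (g := fun _ => 1) (integrableOn_const (by simp))
    (hm.mono_measure (Measure.restrict_mono hsub le_rfl)) ?_
  exact (ae_restrict_mem measurableSet_Ioc).mono fun t ht => hb t (hsub ht)

theorem summable_and_integrableOn_of_isBigO {ρ : ℝ → ℝ} {e : ℝ} (he : e < -1)
    (hm : AEStronglyMeasurable ρ (volume.restrict (Ioi 0))) (hb : ∀ t, 0 < t → |ρ t| ≤ 1)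
    (hO : ρ =O[atTop] fun t => t ^ e) :
    Summable (fun n : ℕ => ρ (n + 1)) ∧ IntegrableOn ρ (Ioi 0) := by
  constructor
  · have h := summable_of_isBigO_nat (Real.summable_nat_rpow.2 he)
      (hO.comp_tendsto tendsto_natCast_atTop_atTop)
    simpa using (summable_nat_add_iff 1).2 h
  · obtain ⟨C, hC⟩ := hO.bound
    obtain ⟨T, hT⟩ := eventually_atTop.1 hC
    have hT0 : 0 < max T 1 := lt_max_of_lt_right one_pos
    rw [← Ioc_union_Ioi_eq_Ioi hT0.le]
    refine (integrableOn_Ioc_of_abs_le_one hm hb le_rfl).union ?_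
    refine Integrable.mono' ((integrableOn_Ioi_rpow_of_lt he hT0).const_mul C)
      (hm.mono_measure (Measure.restrict_mono (Ioi_subset_Ioi hT0.le) le_rfl)) ?_
    refine (ae_restrict_mem measurableSet_Ioi).mono fun t ht => ?_
    have ht' : max T 1 < t := ht
    have h := hT t ((le_max_left _ _).trans ht'.le)
    rwa [Real.norm_of_nonneg (Real.rpow_nonneg (hT0.trans ht').le _)] at h

theorem hasDerivAt_two_mul_sqrt_log {t : ℝ} (ht : 1 < t) :
    HasDerivAt (fun t => 2 * √(Real.log t)) (t * √(Real.log t))⁻¹ t := by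
  have hl := Real.log_pos ht
  have h := (((Real.hasDerivAt_log (by linarith : t ≠ 0)).sqrt hl.ne').const_mul 2)
  have hs := Real.sqrt_pos.2 hl
  have ht0 : 0 < t := by linarith
  refine h.congr_deriv ?_
  field_simp

/-- With x, y the square roots of log t and log (t + 1), 2x(y - x) ≤ y² - x² ≤ 1/t. This makes the
lower bound on the sum telescope. -/
theorem two_mul_sqrt_log_sub_le {t : ℝ} (ht : 1 < t) :
    2 * √(Real.log (t + 1)) - 2 * √(Real.log t) ≤ (t * √(Real.log t))⁻¹ := by
  have hl := Real.log_pos ht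
  have ht0 : 0 < t := by linarith
  have hx := Real.sqrt_pos.2 hl
  have hle : Real.log t ≤ Real.log (t + 1) := Real.log_le_log ht0 (by linarith)
  have hxy := Real.sqrt_le_sqrt hle
  have h1 : Real.log (t + 1) - Real.log t ≤ t⁻¹ := by
    rw [← Real.log_div (by linarith) ht0.ne']
    refine (Real.log_le_sub_one_of_pos (by positivity)).trans_eq ?_
    field_simp
    ring
  rw [← Real.sq_sqrt hl.le, ← Real.sq_sqrt (hl.le.trans hle)] at h1
  rw [mul_inv, ← div_eq_mul_inv, le_div_iff₀ hx]
  nlinarith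

theorem tendsto_two_mul_sqrt_log :
    Tendsto (fun t => 2 * √(Real.log t)) atTop atTop :=
  (Real.tendsto_sqrt_atTop.comp Real.tendsto_log_atTop).const_mul_atTop two_pos

/-- The minorant is the slowest-diverging case needed, so one comparison serves all three regimes.
The bound |ρ| ≤ 1 controls the initial range, where the asymptotics say nothing. -/
theorem tendsto_sum_and_integral_of_le {ρ : ℝ → ℝ} {c : ℝ} (hc : 0 < c)
    (hm : AEStronglyMeasurable ρ (volume.restrict (Ioi 0))) (hb : ∀ t, 0 < t → |ρ t| ≤ 1)
    (hle : ∀ᶠ t in atTop, c * (t * √(Real.log t))⁻¹ ≤ ρ t) :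
    Tendsto (fun N : ℕ => ∑ n ∈ Finset.Icc 1 N, ρ n) atTop atTop ∧
      (∀ T : ℝ, 1 ≤ T → IntervalIntegrable ρ volume 1 T) ∧
      Tendsto (fun T : ℝ => ∫ t in (1 : ℝ)..T, ρ t) atTop atTop := by
  have hint : ∀ a b : ℝ, 0 ≤ a → a ≤ b → IntervalIntegrable ρ volume a b := fun a b ha hab =>
    (intervalIntegrable_iff_integrableOn_Ioc_of_le hab).2
      (integrableOn_Ioc_of_abs_le_one hm hb ha)
  obtain ⟨T₀, hT₀⟩ := eventually_atTop.1 hle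
  refine ⟨?_, fun T hT => hint 1 T zero_le_one hT, ?_⟩
  -- The 2 keeps log t positive beyond the cutoff.
  · obtain ⟨m, hm⟩ := exists_nat_ge (max T₀ 2)
    have hmT : T₀ ≤ m := (le_max_left _ _).trans hm
    have hm2 : (2 : ℝ) ≤ m := (le_max_right _ _).trans hm
    have hlow : ∀ N : ℕ, m ≤ N → c * (2 * √(Real.log (N + 1))) +
        ((∑ n ∈ Finset.Icc 1 m, ρ n) - c * (2 * √(Real.log (m + 1)))) ≤
          ∑ n ∈ Finset.Icc 1 N, ρ n := by
      intro N hN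
      induction N, hN using Nat.le_induction with
      | base => linarith
      | succ N hN ih =>
        have hN' : (m : ℝ) ≤ N := Nat.cast_le.2 hN
        rw [Finset.sum_Icc_succ_top (by omega)]
        have h1 := hT₀ ((N + 1 : ℕ) : ℝ) (by push_cast; linarith)
        have h2 := two_mul_sqrt_log_sub_le (t := ((N + 1 : ℕ) : ℝ)) (by push_cast; linarith)
        have h3 := mul_le_mul_of_nonneg_left h2 hc.le
        push_cast at h1 h2 h3 ⊢
        linarith
    have hlim : Tendsto (fun N : ℕ => c * (2 * √(Real.log ((N : ℝ) + 1))) +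
        ((∑ n ∈ Finset.Icc 1 m, ρ n) - c * (2 * √(Real.log (m + 1))))) atTop atTop := by
      refine tendsto_atTop_add_const_right _ _ (Tendsto.const_mul_atTop hc ?_)
      exact tendsto_two_mul_sqrt_log.comp
        (tendsto_atTop_add_const_right _ _ tendsto_natCast_atTop_atTop)
    exact tendsto_atTop_mono' _ ((eventually_ge_atTop m).mono hlow) hlim
  · set m := max T₀ 2 with hmdef
    have hmT : T₀ ≤ m := le_max_left _ _
    have hm2 : 2 ≤ m := le_max_right _ _
    have hlim : Tendsto (fun T : ℝ => c * (2 * √(Real.log T)) +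
        ((∫ t in (1 : ℝ)..m, ρ t) - c * (2 * √(Real.log m)))) atTop atTop :=
      tendsto_atTop_add_const_right _ _ (tendsto_two_mul_sqrt_log.const_mul_atTop hc)
    refine tendsto_atTop_mono' _ ((eventually_ge_atTop m).mono fun T hT => ?_) hlim
    have hcont : ContinuousOn (fun t => (t * √(Real.log t))⁻¹) (uIcc m T) := by
      rw [uIcc_of_le hT]
      intro t ht
      have ht1 : 1 < t := by linarith [ht.1]
      have hs := Real.sqrt_pos.2 (Real.log_pos ht1)
      refine ContinuousAt.continuousWithinAt (ContinuousAt.inv₀ (continuousAt_id.mul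
        (Real.continuousAt_log (by linarith)).sqrt) ?_)
      exact (mul_pos (by simpa using one_pos.trans ht1) hs).ne'
    have hF := intervalIntegral.integral_eq_sub_of_hasDerivAt (a := m) (b := T)
      (f := fun t => 2 * √(Real.log t)) (f' := fun t => (t * √(Real.log t))⁻¹)
      (fun t ht => hasDerivAt_two_mul_sqrt_log (by
        rw [uIcc_of_le hT] at ht
        linarith [ht.1])) hcont.intervalIntegrable
    have hmono : ∫ t in m..T, c * (t * √(Real.log t))⁻¹ ≤ ∫ t in m..T, ρ t :=
      intervalIntegral.integral_mono_on hT (hcont.intervalIntegrable.const_mul c)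
        (hint m T (by linarith) hT) fun t ht => hT₀ t (hmT.trans ht.1)
    rw [intervalIntegral.integral_const_mul, hF] at hmono
    simp only
    rw [← intervalIntegral.integral_add_adjacent_intervals
      (hint 1 m zero_le_one (by linarith)) (hint m T (by linarith) hT)]
    linarith

/-- The correlation of `X_1` and `X_{t+1} - X_t` in terms of the kernel. -/
noncomputable def volterraCorr (α β γ t : ℝ) : ℝ :=
  (∫ s in Ioi 0, kernel α β γ 1 s * (kernel α β γ (t + 1) s - kernel α β γ t s)) /
    (√(∫ s in Ioi 0, kernel α β γ 1 s ^ 2) *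
      √(∫ s in Ioi 0, (kernel α β γ (t + 1) s - kernel α β γ t s) ^ 2))

variable {α β γ : ℝ}

theorem measurable_volterraCorr : Measurable (volterraCorr α β γ) := by
  have h0 : Measurable fun x : ℝ × ℝ => kernel α β γ 1 x.2 :=
    (measurable_kernel_right 1).comp measurable_snd
  have h1 : Measurable fun x : ℝ × ℝ => kernel α β γ (x.1 + 1) x.2 - kernel α β γ x.1 x.2 :=
    (measurable_kernel.comp ((measurable_fst.add_const 1).prodMk measurable_snd)).sub
      measurable_kernel
  have h2 := (StronglyMeasurable.integral_prod_right' (ν := volume.restrict (Ioi (0 : ℝ)))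
    (h0.mul h1).stronglyMeasurable).measurable
  have h3 := (StronglyMeasurable.integral_prod_right' (ν := volume.restrict (Ioi (0 : ℝ)))
    (h1.pow_const 2).stronglyMeasurable).measurable
  exact h2.div (measurable_const.mul h3.sqrt)

theorem abs_volterraCorr_le_one (hα : -(1 / 2) < α) (hγ : -1 < γ) (hαβγ : -(3 / 2) < α + β + γ)
    (t : ℝ) : |volterraCorr α β γ t| ≤ 1 := by
  have hf := memLp_kernel hα hγ hαβγ 1
  have hg := (memLp_kernel hα hγ hαβγ (t + 1)).sub (memLp_kernel hα hγ hαβγ t)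
  -- Cauchy–Schwarz, in a form also valid when a norm vanishes.
  have h := abs_real_inner_div_norm_mul_norm_le_one (hf.toLp _) (hg.toLp _)
  rw [norm_eq_sqrt_real_inner, norm_eq_sqrt_real_inner, inner_toLp, inner_toLp, inner_toLp] at h
  simpa only [volterraCorr, sq, Pi.sub_apply] using h

/-- The asymptotics of the correlation, given that of the variance for `β = 0`. -/
theorem exists_tendsto_volterraCorr (hα : -(1 / 2) < α) (hγ : -1 < γ)
    (hαβγ : -(3 / 2) < α + β + γ) {ψ : ℝ → ℝ} {L : ℝ} (hL : 0 < L) (hψ : ∀ᶠ t in atTop, 0 < ψ t)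
    (hI : Tendsto (fun t => incrVar α γ t / (t ^ (2 * α) * ψ t)) atTop (𝓝 L)) :
    ∃ c, 0 < c ∧
      Tendsto (fun t => volterraCorr α β γ t / (t ^ (γ - α) / √(ψ t))) atTop (𝓝 c) := by
  have hA := integral_kernel_mul_rpow_pos hα hγ hαβγ
  have hV := Real.sqrt_pos.2 (integral_kernel_sq_pos hα hγ hαβγ)
  have hcov := tendsto_covariance hα hγ hαβγ
  have hpos : ∀ e : ℝ, ∀ᶠ t : ℝ in atTop, 0 < t ^ e := fun e =>
    (eventually_gt_atTop 0).mono fun t ht => Real.rpow_pos_of_pos ht _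
  have hvar := tendsto_div_of_mem_Icc (2 * |β|) (hpos (2 * β))
    (by filter_upwards [hpos (2 * α), hψ] with t h1 h2 using mul_pos h1 h2) hI
    fun t ht => variance_mem_Icc hα hγ hαβγ ht
  refine ⟨_, div_pos hA (mul_pos hV (Real.sqrt_pos.2 hL)),
    (hcov.div (hvar.sqrt.const_mul _) (mul_pos hV (Real.sqrt_pos.2 hL)).ne').congr' ?_⟩
  filter_upwards [eventually_gt_atTop 0, hψ] with t ht h1
  have e1 : √(t ^ (2 * β) * (t ^ (2 * α) * ψ t)) = t ^ β * t ^ α * √(ψ t) := by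
    rw [← mul_assoc, Real.sqrt_mul (by positivity), ← rpow_sq ht.le, ← rpow_sq ht.le, ← mul_pow,
      Real.sqrt_sq (by positivity)]
  have h2 := Real.sqrt_pos.2 h1
  have h3 := Real.rpow_pos_of_pos ht α
  have h4 := Real.rpow_pos_of_pos ht β
  have h5 := Real.rpow_pos_of_pos ht γ
  simp only [Pi.div_apply]
  rw [Real.sqrt_div' _ (by positivity), e1, volterraCorr, Real.rpow_add ht, Real.rpow_sub ht]
  field_simp

/-- The consequences of the asymptotics of the correlation. -/
theorem isEquivalent_and_summable_of_tendsto_div {ρ τ : ℝ → ℝ} {c : ℝ} (hc : 0 < c)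
    (hm : AEStronglyMeasurable ρ (volume.restrict (Ioi 0))) (hb : ∀ t, 0 < t → |ρ t| ≤ 1)
    (hτ : ∀ᶠ t in atTop, 0 < τ t) (hρ : Tendsto (fun t => ρ t / τ t) atTop (𝓝 c)) :
    (ρ ~[atTop] fun t => c * τ t) ∧
    (∀ e : ℝ, e < -1 → (∀ᶠ t in atTop, τ t ≤ t ^ e) →
      Summable (fun n : ℕ => ρ (n + 1)) ∧ IntegrableOn ρ (Ioi 0)) ∧
    ((∀ᶠ t in atTop, (t * √(Real.log t))⁻¹ ≤ τ t) →
      Tendsto (fun N : ℕ => ∑ n ∈ Finset.Icc 1 N, ρ n) atTop atTop ∧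
      (∀ T : ℝ, 1 ≤ T → IntervalIntegrable ρ volume 1 T) ∧
      Tendsto (fun T : ℝ => ∫ t in (1 : ℝ)..T, ρ t) atTop atTop) := by
  have heq : ρ ~[atTop] fun t => c * τ t := by
    refine (isEquivalent_iff_tendsto_one (hτ.mono fun t ht => (mul_pos hc ht).ne')).2 ?_
    have h := hρ.div_const c
    rw [div_self hc.ne'] at h
    refine h.congr fun t => ?_
    rw [Pi.div_apply, div_div, mul_comm c]
  refine ⟨heq, fun e he hle => ?_, fun hle => ?_⟩
  · refine summable_and_integrableOn_of_isBigO he hm hb (heq.isBigO.trans ?_)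
    refine IsBigO.of_bound c ?_
    filter_upwards [hτ, hle] with t h1 h2
    rw [norm_mul, Real.norm_of_nonneg hc.le, Real.norm_of_nonneg h1.le,
      Real.norm_of_nonneg (h1.le.trans h2)]
    exact mul_le_mul_of_nonneg_left h2 hc.le
  · refine tendsto_sum_and_integral_of_le (half_pos hc) hm hb ?_
    filter_upwards [hτ, hle, hρ.eventually_const_lt (half_lt_self hc)] with t h1 h2 h3
    exact (mul_le_mul_of_nonneg_left h2 (half_pos hc).le).trans ((lt_div_iff₀ h1).1 h3).le

theorem eventually_inv_mul_sqrt_log_le_rpow {e : ℝ} (he : -1 ≤ e) :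
    ∀ᶠ t in atTop, (t * √(Real.log t))⁻¹ ≤ t ^ e := by
  filter_upwards [eventually_ge_atTop 1, Real.tendsto_log_atTop.eventually_ge_atTop 1] with t h1 h2
  have ht : 0 < t := by linarith
  rw [mul_inv]
  calc t⁻¹ * (√(Real.log t))⁻¹ ≤ t⁻¹ * 1 :=
        mul_le_mul_of_nonneg_left (inv_le_one_of_one_le₀ (Real.one_le_sqrt.2 h2)) (by positivity)
    _ = t ^ (-1 : ℝ) := by rw [mul_one, Real.rpow_neg_one]
    _ ≤ t ^ e := Real.rpow_le_rpow_of_exponent_le h1 he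

theorem corr_eq_volterraCorr (hα : -(1 / 2) < α) (hγ : -1 < γ) (hαβγ : -(3 / 2) < α + β + γ)
    {Ω : Type*} [MeasurableSpace Ω] {P : Measure Ω} [IsProbabilityMeasure P]
    {W : ℝ≥0 → Ω → ℝ} (hW : IsBrownianReal W P) {X : ℝ → Ω → ℝ}
    (hX : ∀ t, 0 ≤ t → X t =ᵐ[P] volterraProcess W P α β γ t) {t : ℝ} (ht : 0 ≤ t) :
    corr (X 1) (X (t + 1) - X t) P = volterraCorr α β γ t :=
  corr_sub_eq hW (memLp_kernel hα hγ hαβγ 1) (memLp_kernel hα hγ hαβγ (t + 1))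
    (memLp_kernel hα hγ hαβγ t) (hX 1 zero_le_one) (hX (t + 1) (by linarith)) (hX t ht)

/-- The consequences of the asymptotics of the correlation for every version of the process. -/
theorem exists_const_isEquivalent_and_summable (hα : -(1 / 2) < α) (hγ : -1 < γ)
    (hαβγ : -(3 / 2) < α + β + γ) {ψ τ : ℝ → ℝ} {L : ℝ} (hL : 0 < L)
    (hψ : ∀ᶠ t in atTop, 0 < ψ t)
    (hI : Tendsto (fun t => incrVar α γ t / (t ^ (2 * α) * ψ t)) atTop (𝓝 L))
    (hτ : ∀ᶠ t in atTop, t ^ (γ - α) / √(ψ t) = τ t) :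
    ∃ c, 0 < c ∧ ∀ ρ : ℝ → ℝ, (∀ t, 0 ≤ t → ρ t = volterraCorr α β γ t) →
      (ρ ~[atTop] fun t => c * τ t) ∧
      (∀ e : ℝ, e < -1 → (∀ᶠ t in atTop, τ t ≤ t ^ e) →
        Summable (fun n : ℕ => ρ (n + 1)) ∧ IntegrableOn ρ (Ioi 0)) ∧
      ((∀ᶠ t in atTop, (t * √(Real.log t))⁻¹ ≤ τ t) →
        Tendsto (fun N : ℕ => ∑ n ∈ Finset.Icc 1 N, ρ n) atTop atTop ∧
        (∀ T : ℝ, 1 ≤ T → IntervalIntegrable ρ volume 1 T) ∧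
        Tendsto (fun T : ℝ => ∫ t in (1 : ℝ)..T, ρ t) atTop atTop) := by
  obtain ⟨c, hc, hlim⟩ := exists_tendsto_volterraCorr hα hγ hαβγ hL hψ hI
  refine ⟨c, hc, fun ρ hρ => isEquivalent_and_summable_of_tendsto_div hc ?_ (fun t ht => ?_) ?_
    (hlim.congr' ?_)⟩
  · refine (measurable_volterraCorr (α := α) (β := β) (γ := γ)).aestronglyMeasurable.congr ?_
    exact (ae_restrict_mem measurableSet_Ioi).mono fun t ht => (hρ t (le_of_lt ht)).symm
  · rw [hρ t ht.le]
    exact abs_volterraCorr_le_one hα hγ hαβγ t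
  · filter_upwards [hψ, hτ, eventually_gt_atTop 0] with t h1 h2 h3
    rw [← h2]
    exact div_pos (Real.rpow_pos_of_pos h3 _) (Real.sqrt_pos.2 h1)
  · filter_upwards [hτ, eventually_ge_atTop 0] with t h1 h2
    rw [h1, hρ t h2]

end Conclusion

end GaussianVolterra

/-! ### The main theorem, by the position of γ relative to -1/2 -/

theorem mainTheorem4 (α β γ : ℝ) (hα : -(1 / 2) < α) (hγ : -1 < γ)
    (hαβγ : -(3 / 2) < α + β + γ) :
    ∃ c : ℝ, 0 < c ∧
      ∀ (Ω : Type*) [MeasurableSpace Ω] (P : Measure Ω) [IsProbabilityMeasure P]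
        (W : ℝ≥0 → Ω → ℝ) (_ : IsBrownianReal W P)
        (X : ℝ → Ω → ℝ) (_ : ∀ t, 0 ≤ t → X t =ᵐ[P] GaussianVolterra.volterraProcess W P α β γ t)
        (ρ : ℝ → ℝ) (_ : ∀ t, 0 ≤ t → ρ t = GaussianVolterra.corr (X 1) (X (t + 1) - X t) P),
        (γ < -(1 / 2) → ρ ~[atTop] fun t => c * t ^ (γ - α)) ∧
        (γ = -(1 / 2) →
          ρ ~[atTop] fun t => c * t ^ (-(1 / 2) - α) * (Real.log t) ^ (-(1 / 2) : ℝ)) ∧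
        (-(1 / 2) < γ → ρ ~[atTop] fun t => c * t ^ (-(1 / 2) - α)) ∧
        (min γ (-(1 / 2)) < α - 1 →
          Summable (fun n : ℕ => ρ (n + 1)) ∧ IntegrableOn ρ (Ioi 0)) ∧
        (α ≤ 1 / 2 → α - 1 ≤ γ →
          Tendsto (fun N : ℕ => ∑ n ∈ Finset.Icc 1 N, ρ n) atTop atTop ∧
          (∀ T : ℝ, 1 ≤ T → IntervalIntegrable ρ volume 1 T) ∧
          Tendsto (fun T : ℝ => ∫ t in (1 : ℝ)..T, ρ t) atTop atTop) := by
  rcases lt_trichotomy γ (-(1 / 2)) with hlt | heq | hgt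
  · obtain ⟨c, hc, h⟩ := GaussianVolterra.exists_const_isEquivalent_and_summable
      hα hγ hαβγ (ψ := fun _ => 1)
      (τ := fun t => t ^ (γ - α)) (GaussianVolterra.integral_incr_sq_pos hγ hlt)
      (Eventually.of_forall fun _ => one_pos)
      (by simpa using GaussianVolterra.tendsto_incrVar_of_lt hα hγ hlt)
      (by simp)
    refine ⟨c, hc, fun Ω _ P _ W hW X hX ρ hρ => ?_⟩
    obtain ⟨h1, h2, h3⟩ := h ρ fun t ht =>
      (hρ t ht).trans (GaussianVolterra.corr_eq_volterraCorr hα hγ hαβγ hW hX ht)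
    refine ⟨fun _ => h1, fun h => absurd h hlt.ne, fun h => absurd h hlt.not_gt, fun h => ?_,
      fun _ h => h3 (GaussianVolterra.eventually_inv_mul_sqrt_log_le_rpow (by linarith))⟩
    rw [min_eq_left hlt.le] at h
    exact h2 (γ - α) (by linarith) (Eventually.of_forall fun _ => le_rfl)
  · subst heq
    obtain ⟨c, hc, h⟩ := GaussianVolterra.exists_const_isEquivalent_and_summable
      hα hγ hαβγ (ψ := Real.log)
      (τ := fun t => t ^ (-(1 / 2) - α) * (Real.log t) ^ (-(1 / 2) : ℝ)) one_pos
      (Real.tendsto_log_atTop.eventually_gt_atTop 0) (GaussianVolterra.tendsto_incrVar_of_eq hα)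
      (by
        filter_upwards [eventually_ge_atTop 1] with t ht
        rw [Real.rpow_neg (Real.log_nonneg ht), ← Real.sqrt_eq_rpow, div_eq_mul_inv])
    refine ⟨c, hc, fun Ω _ P _ W hW X hX ρ hρ => ?_⟩
    obtain ⟨h1, h2, h3⟩ := h ρ fun t ht =>
      (hρ t ht).trans (GaussianVolterra.corr_eq_volterraCorr hα hγ hαβγ hW hX ht)
    refine ⟨fun h => absurd h (lt_irrefl _), fun _ => by simpa only [mul_assoc] using h1,
      fun h => absurd h (lt_irrefl _), fun h => ?_, fun h _ => h3 ?_⟩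
    · rw [min_self] at h
      refine h2 (-(1 / 2) - α) (by linarith) ?_
      filter_upwards [eventually_gt_atTop 0,
        Real.tendsto_log_atTop.eventually_ge_atTop 1] with t ht hl
      exact mul_le_of_le_one_right (Real.rpow_nonneg ht.le _)
        (Real.rpow_le_one_of_one_le_of_nonpos hl (by norm_num))
    -- At α = 1/2 the comparison is an equality: this case dictates the minorant 1 / (t √(log t)).
    · filter_upwards [eventually_ge_atTop 1] with t ht
      rw [Real.rpow_neg (Real.log_nonneg ht), ← Real.sqrt_eq_rpow, mul_inv]
      refine mul_le_mul_of_nonneg_right ?_ (by positivity)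
      rw [← Real.rpow_neg_one]
      exact Real.rpow_le_rpow_of_exponent_le ht (by linarith)
  · obtain ⟨c, hc, h⟩ := GaussianVolterra.exists_const_isEquivalent_and_summable
      hα hγ hαβγ (ψ := fun t => t ^ (2 * γ + 1))
      (τ := fun t => t ^ (-(1 / 2) - α))
      (GaussianVolterra.integral_one_sub_rpow_mul_rpow_pos (by linarith) (by linarith))
      ((eventually_gt_atTop 0).mono fun t ht => Real.rpow_pos_of_pos ht _)
      (GaussianVolterra.tendsto_incrVar_of_gt hα hgt)
      (by
        filter_upwards [eventually_gt_atTop 0] with t ht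
        rw [Real.sqrt_eq_rpow, ← Real.rpow_mul ht.le, ← Real.rpow_sub ht]
        congr 1
        ring)
    refine ⟨c, hc, fun Ω _ P _ W hW X hX ρ hρ => ?_⟩
    obtain ⟨h1, h2, h3⟩ := h ρ fun t ht =>
      (hρ t ht).trans (GaussianVolterra.corr_eq_volterraCorr hα hγ hαβγ hW hX ht)
    refine ⟨fun h => absurd h hgt.not_gt, fun h => absurd h hgt.ne', fun _ => h1, fun h => ?_,
      fun h _ => h3 (GaussianVolterra.eventually_inv_mul_sqrt_log_le_rpow (by linarith))⟩
    rw [min_eq_right hgt.le] at h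
    exact h2 (-(1 / 2) - α) (by linarith) (Eventually.of_forall fun _ => le_rfl)
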